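/- For a finite group $G$, the commuting conjugacy class graph $\Gamma_G$ is the simple graph whose vertices are the conjugacy classes $x^G$ of the non-central elements $x\in G$; two distinct vertices $x^G,y^G$ are adjacent iff $x'y'=y'x'$ for some $x'\in x^G$, $y'\in y^G$. For a finite graph $\mathcal G$ with vertices $v_1,\dots,v_N$, let $CN(\mathcal G)$ be the $N\times N$ matrix with zero diagonal whose $(i,j)$ entry, $i\ne j$, is the number of common neighbours of $v_i$ and $v_j$; let $CNRS(\mathcal G)$ be the diagonal matrix of the row sums of $CN(\mathcal G)$, and $\Delta(\mathcal G)=\operatorname{tr}(CNRS(\mathcal G))/N$. The CNL-energy $LE_{CN}(\mathcal G)$ (respectively the CNSL-energy $LE^+_{CN}(\mathcal G)$) is $\sum_\alpha|\alpha-\Delta(\mathcal G)|$ over the eigenvalues $\alpha$, with multiplicity, of $CNRS(\mathcal G)-CN(\mathcal G)$ (respectively of $CNRS(\mathcal G)+CN(\mathcal G)$). A graph $\mathcal G$ on $N$ vertices is CNL-hyperenergetic if $LE_{CN}(\mathcal G)>LE_{CN}(K_N)$ and CNL-borderenergetic if $LE_{CN}(\mathcal G)=LE_{CN}(K_N)$;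 CNSL-hyperenergetic and CNSL-borderenergetic are defined likewise with $LE^+_{CN}$. Here $LE_{CN}(K_N)=LE^+_{CN}(K_N)=2(N-1)(N-2)$ for $N\ge1$; for the graph without vertices ($N=0$) all energies are empty sums, equal to $0$. Consider the groups - $D_{2n}=\langle x,y: x^n=y^2=1,\ yxy^{-1}=x^{-1}\rangle$, $n\ge3$; - $T_{4n}=\langle x,y: x^{2n}=1,\ x^n=y^2,\ y^{-1}xy=x^{-1}\rangle$, $n\ge2$; - $U_{6n}=\langle x,y: x^{2n}=y^3=1,\ x^{-1}yx=y^{-1}\rangle$, $n\ge2$; - $SD_{8n}=\langle x,y: x^{4n}=y^2=1,\ yxy=x^{2n-1}\rangle$, $n\ge2$; - $U_{(n,m)}=\langle x,y: x^{2n}=y^m=1,\ x^{-1}yx=y^{-1}\rangle$, $n\ge2$, $m\ge2$. Then, for $G$ any member of these families: 1. $\Gamma_G$ is CNL-borderenergetic if and only if $G$ is $D_6$, $D_{22}$, or $U_{(n,2)}$ with $n\ge2$. 2. $\Gamma_G$ is CNL-hyperenergetic if and only if $G$ is $D_{2n}$ with $n\ge13$; $T_{4n}$ with $n\ge7$; $SD_{8n}$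 with $n\ge4$; or $U_{(n,m)}$ with $(n,m)$ not among: $m\in\{2,3,4,6\}$ (any $n\ge2$); $m=5$ and $n\in\{2,3\}$; $m=8$ and $n=2$. 3. $\Gamma_G$ is CNSL-borderenergetic if and only if $G$ is $D_6$, or $U_{(n,2)}$ with $n\ge2$. 4. $\Gamma_G$ is CNSL-hyperenergetic if and only if $G$ is $D_{2n}$ with $n$ even and $n\ge20$; $T_{4n}$ with $n\ge10$; $SD_{8n}$ with $n\ge6$; or $U_{(n,m)}$ with $(n,m)$ not among: $m\in\{2,3,4,6\}$ (any $n\ge2$); $m\in\{5,7,9\}$ and $n=2$; $m=5$ and $n\in\{3,4\}$; $m\in\{8,10\}$ and $n=2$. In particular, no $\Gamma_{U_{6n}}$ with $n\ge2$ has any of the four properties. (The groups $U_{(n,2)}$ are abelian, so their graphs $\Gamma_G$ have no vertices.) As always in such lists, "$G$ is $D_{2n}$ with …" is meant family by family: a member of a family has the property exactly for the listed parameters of that family. -/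

import Mathlib

namespace CCC

section Graph

variable {V : Type*} [Fintype V]

open Classical in
/-- The common neighbourhood matrix of a graph: the `(i, j)` entry is the number of common
neighbours of `i` and `j` when `i ≠ j`, and `0` when `i = j`. -/
noncomputable def cnMatrix (G : SimpleGraph V) : Matrix V V ℝ :=
  Matrix.of fun i j => if i = j then 0 else ((G.commonNeighbors i j).ncard : ℝ)

open Classical in
/-- The diagonal matrix of the row sums of the common neighbourhood matrix. -/
noncomputable def cnrsMatrix (G : SimpleGraph V) : Matrix V V ℝ :=
  Matrix.diagonal fun i => ∑ k, cnMatrix G i k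

/-- The common neighbourhood Laplacian matrix. -/
noncomputable def cnlMatrix (G : SimpleGraph V) : Matrix V V ℝ :=
  cnrsMatrix G - cnMatrix G

/-- The common neighbourhood signless Laplacian matrix. -/
noncomputable def cnslMatrix (G : SimpleGraph V) : Matrix V V ℝ :=
  cnrsMatrix G + cnMatrix G

/-- The average `Δ(G)` of the row sums of the common neighbourhood matrix. For a graph without
vertices this is the junk value `0 / 0`, but it is then never used (see `deviation`). -/
noncomputable def cnMean (G : SimpleGraph V) : ℝ :=
  (cnrsMatrix G).trace / (Fintype.card V : ℝ)

open Classical in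
/-- The multiset of eigenvalues of a real square matrix, with multiplicities. All the matrices used
here are symmetric, so that all their eigenvalues are real. -/
noncomputable def spectrumMultiset (M : Matrix V V ℝ) : Multiset ℝ :=
  M.charpoly.roots

/-- The sum of `|α - c|` over the eigenvalues `α` of `M`, counted with multiplicity; it is an empty
sum if the index set is empty. -/
noncomputable def deviation (M : Matrix V V ℝ) (c : ℝ) : ℝ :=
  ((spectrumMultiset M).map fun α => |α - c|).sum

/-- The common neighbourhood Laplacian energy of a graph. -/
noncomputable def cnlEnergy (G : SimpleGraph V) : ℝ :=
  deviation (cnlMatrix G) (cnMean G)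

/-- The common neighbourhood signless Laplacian energy of a graph. -/
noncomputable def cnslEnergy (G : SimpleGraph V) : ℝ :=
  deviation (cnslMatrix G) (cnMean G)

/-- The CNL-energy exceeds that of the complete graph on the same vertices. -/
def IsCNLHyperenergetic (G : SimpleGraph V) : Prop :=
  cnlEnergy (⊤ : SimpleGraph V) < cnlEnergy G

/-- The CNL-energy equals that of the complete graph on the same vertices. -/
def IsCNLBorderenergetic (G : SimpleGraph V) : Prop :=
  cnlEnergy G = cnlEnergy (⊤ : SimpleGraph V)

/-- The CNSL-energy exceeds that of the complete graph on the same vertices. -/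
def IsCNSLHyperenergetic (G : SimpleGraph V) : Prop :=
  cnslEnergy (⊤ : SimpleGraph V) < cnslEnergy G

/-- The CNSL-energy equals that of the complete graph on the same vertices. -/
def IsCNSLBorderenergetic (G : SimpleGraph V) : Prop :=
  cnslEnergy G = cnslEnergy (⊤ : SimpleGraph V)

/- On a nonempty vertex set of `N` elements, the energies of the complete graph are
`2 (N - 1) (N - 2)`, so that the four notions above are comparisons with this number. For the graph
without vertices, all energies are empty sums, hence `0`, and it is its own complete graph. -/

open Classical in
theorem cnMatrix_top : cnMatrix (⊤ : SimpleGraph V) =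
    Matrix.of fun i j => if i = j then (0 : ℝ) else (Fintype.card V : ℝ) - 2 := by
  ext i j
  simp only [cnMatrix, Matrix.of_apply]
  split_ifs with h
  · rfl
  · have h2 : ((⊤ : SimpleGraph V).commonNeighbors i j).ncard = Fintype.card V - 2 := by
      rw [← SimpleGraph.card_commonNeighbors_top (V := V) h, Set.ncard_eq_toFinset_card',
        Set.toFinset_card]
    have h3 : 2 ≤ Fintype.card V := Fintype.one_lt_card_iff.mpr ⟨i, j, h⟩
    rw [h2, Nat.cast_sub h3, Nat.cast_ofNat]

open Classical in
theorem cnrsMatrix_top : cnrsMatrix (⊤ : SimpleGraph V) =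
    Matrix.diagonal fun _ => ((Fintype.card V : ℝ) - 1) * ((Fintype.card V : ℝ) - 2) := by
  unfold cnrsMatrix
  congr 1
  funext i
  rw [cnMatrix_top]
  have : ∀ k : V, (if i = k then (0 : ℝ) else (Fintype.card V : ℝ) - 2) =
      ((Fintype.card V : ℝ) - 2) - (if i = k then (Fintype.card V : ℝ) - 2 else 0) := by
    intro k; split_ifs <;> ring
  simp only [Matrix.of_apply, this, Finset.sum_sub_distrib, Finset.sum_ite_eq, Finset.mem_univ,
    if_true, Finset.sum_const, Finset.card_univ, nsmul_eq_mul]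
  ring

open Classical in
theorem cnMean_top [Nonempty V] : cnMean (⊤ : SimpleGraph V) =
    ((Fintype.card V : ℝ) - 1) * ((Fintype.card V : ℝ) - 2) := by
  have h : (Fintype.card V : ℝ) ≠ 0 := by exact_mod_cast Fintype.card_ne_zero
  rw [cnMean, cnrsMatrix_top, Matrix.trace_diagonal, Finset.sum_const, Finset.card_univ,
    nsmul_eq_mul]
  field_simp

open Classical in
theorem spectrumMultiset_const_add_scalar [Nonempty V] (a b : ℝ) :
    spectrumMultiset (Matrix.of fun i j : V => if i = j then a + b else b) =
      Multiset.replicate (Fintype.card V - 1) a + {a + (Fintype.card V : ℝ) * b} := by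
  have hM : (Matrix.of fun i j : V => if i = j then a + b else b) =
      Matrix.vecMulVec (fun _ => b) (fun _ => 1) - Matrix.scalar V (-a) := by
    ext i j
    by_cases h : i = j
    · subst h; simp [Matrix.vecMulVec_apply]; ring
    · simp [Matrix.vecMulVec_apply, h]
  obtain ⟨k, hk⟩ : ∃ k, Fintype.card V = k + 1 :=
    Nat.exists_eq_succ_of_ne_zero Fintype.card_ne_zero
  have hp : (Matrix.of fun i j : V => if i = j then a + b else b).charpoly =
      (Polynomial.X - Polynomial.C a) ^ k *
        (Polynomial.X - Polynomial.C (a + (Fintype.card V : ℝ) * b)) := by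
    rw [hM, Matrix.charpoly_sub_scalar, Matrix.charpoly_vecMulVec]
    simp [hk, dotProduct, Polynomial.smul_eq_C_mul]
    ring
  rw [spectrumMultiset, hp, Polynomial.roots_mul, Polynomial.roots_pow, Polynomial.roots_X_sub_C,
    Polynomial.roots_X_sub_C, hk, Multiset.nsmul_singleton]
  · simp
  · exact mul_ne_zero (pow_ne_zero _ (Polynomial.X_sub_C_ne_zero _)) (Polynomial.X_sub_C_ne_zero _)

open Classical in
theorem cnlMatrix_top : cnlMatrix (⊤ : SimpleGraph V) =
    Matrix.of fun i j : V => if i = j then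
      (Fintype.card V : ℝ) * ((Fintype.card V : ℝ) - 2) + (-((Fintype.card V : ℝ) - 2))
      else -((Fintype.card V : ℝ) - 2) := by
  rw [cnlMatrix, cnrsMatrix_top, cnMatrix_top]
  ext i j
  by_cases h : i = j
  · subst h; simp; ring
  · simp [h]

open Classical in
theorem cnslMatrix_top : cnslMatrix (⊤ : SimpleGraph V) =
    Matrix.of fun i j : V => if i = j then
      ((Fintype.card V : ℝ) - 2) ^ 2 + ((Fintype.card V : ℝ) - 2)
      else (Fintype.card V : ℝ) - 2 := by
  rw [cnslMatrix, cnrsMatrix_top, cnMatrix_top]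
  ext i j
  by_cases h : i = j
  · subst h; simp; ring
  · simp [h]

theorem sub_one_mul_abs_sub_two {n : ℕ} (hn : 0 < n) :
    ((n : ℝ) - 1) * |(n : ℝ) - 2| = ((n : ℝ) - 1) * ((n : ℝ) - 2) := by
  rcases Nat.lt_or_ge n 2 with h | h
  · have : n = 1 := by omega
    subst this; norm_num
  · have : (2 : ℝ) ≤ n := by exact_mod_cast h
    rw [abs_of_nonneg (by linarith)]

/-- The CNL-energy of the complete graph on `N ≥ 1` vertices is `2 (N - 1) (N - 2)`. -/
theorem cnlEnergy_top [Nonempty V] : cnlEnergy (⊤ : SimpleGraph V) =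
    2 * ((Fintype.card V : ℝ) - 1) * ((Fintype.card V : ℝ) - 2) := by
  have h0 : 0 < Fintype.card V := Fintype.card_pos
  have h1 : (1 : ℝ) ≤ Fintype.card V := by exact_mod_cast h0
  rw [cnlEnergy, deviation, cnlMatrix_top, spectrumMultiset_const_add_scalar, cnMean_top]
  simp only [Multiset.map_add, Multiset.map_replicate, Multiset.map_singleton, Multiset.sum_add,
    Multiset.sum_replicate, Multiset.sum_singleton, nsmul_eq_mul, Nat.cast_sub h0, Nat.cast_one]
  have e1 : (Fintype.card V : ℝ) * ((Fintype.card V : ℝ) - 2) -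
      ((Fintype.card V : ℝ) - 1) * ((Fintype.card V : ℝ) - 2) = (Fintype.card V : ℝ) - 2 := by ring
  have e2 : (Fintype.card V : ℝ) * ((Fintype.card V : ℝ) - 2) +
      (Fintype.card V : ℝ) * -((Fintype.card V : ℝ) - 2) -
      ((Fintype.card V : ℝ) - 1) * ((Fintype.card V : ℝ) - 2) =
      -(((Fintype.card V : ℝ) - 1) * ((Fintype.card V : ℝ) - 2)) := by ring
  have e3 := sub_one_mul_abs_sub_two h0
  rw [e1, e2, abs_neg, abs_mul, abs_of_nonneg (by linarith : (0 : ℝ) ≤ (Fintype.card V : ℝ) - 1)]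
  rw [e3]
  ring

/-- The CNSL-energy of the complete graph on `N ≥ 1` vertices is `2 (N - 1) (N - 2)`. -/
theorem cnslEnergy_top [Nonempty V] : cnslEnergy (⊤ : SimpleGraph V) =
    2 * ((Fintype.card V : ℝ) - 1) * ((Fintype.card V : ℝ) - 2) := by
  have h0 : 0 < Fintype.card V := Fintype.card_pos
  have h1 : (1 : ℝ) ≤ Fintype.card V := by exact_mod_cast h0
  rw [cnslEnergy, deviation, cnslMatrix_top, spectrumMultiset_const_add_scalar, cnMean_top]
  simp only [Multiset.map_add, Multiset.map_replicate, Multiset.map_singleton, Multiset.sum_add,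
    Multiset.sum_replicate, Multiset.sum_singleton, nsmul_eq_mul, Nat.cast_sub h0, Nat.cast_one]
  have e1 : ((Fintype.card V : ℝ) - 2) ^ 2 -
      ((Fintype.card V : ℝ) - 1) * ((Fintype.card V : ℝ) - 2) =
      -((Fintype.card V : ℝ) - 2) := by ring
  have e2 : ((Fintype.card V : ℝ) - 2) ^ 2 +
      (Fintype.card V : ℝ) * ((Fintype.card V : ℝ) - 2) -
      ((Fintype.card V : ℝ) - 1) * ((Fintype.card V : ℝ) - 2) =
      ((Fintype.card V : ℝ) - 1) * ((Fintype.card V : ℝ) - 2) := by ring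
  have e3 := sub_one_mul_abs_sub_two h0
  rw [e1, e2, abs_neg, abs_mul, abs_of_nonneg (by linarith : (0 : ℝ) ≤ (Fintype.card V : ℝ) - 1)]
  rw [e3]
  ring

end Graph

section Group

/-- The conjugacy classes of the non-central elements of a group. -/
abbrev Vertex (G : Type*) [Group G] : Type _ :=
  {c : ConjClasses G // ∃ x : G, x ∉ Subgroup.center G ∧ ConjClasses.mk x = c}

noncomputable instance (G : Type*) [Group G] [Finite G] : Fintype (Vertex G) :=
  Fintype.ofFinite _

/-- The commuting conjugacy class graph of a group: two distinct classes of non-central elements are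
adjacent when some element of the one commutes with some element of the other. -/
def cccGraph (G : Type*) [Group G] : SimpleGraph (Vertex G) where
  Adj c d := c ≠ d ∧ ∃ x y : G, ConjClasses.mk x = c.1 ∧ ConjClasses.mk y = d.1 ∧ x * y = y * x
  symm := ⟨fun _ _ ⟨h, x, y, hx, hy, e⟩ => ⟨h.symm, y, x, hy, hx, e.symm⟩⟩
  loopless := ⟨fun _ h => h.1 rfl⟩

/-- The generator `x` of the free group on two generators. -/
def genX : FreeGroup (Fin 2) := FreeGroup.of 0

/-- The generator `y` of the free group on two generators. -/
def genY : FreeGroup (Fin 2) := FreeGroup.of 1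

/-- The group `U_{(n,m)} = ⟨x, y : x ^ (2n) = y ^ m = 1, x⁻¹ y x = y⁻¹⟩`. -/
abbrev GroupU (n m : ℕ) : Type :=
  PresentedGroup ({genX ^ (2 * n), genY ^ m, (genX⁻¹ * genY * genX) * (genY⁻¹)⁻¹} :
    Set (FreeGroup (Fin 2)))

/-- The group `U_{6n} = ⟨x, y : x ^ (2n) = y ^ 3 = 1, x⁻¹ y x = y⁻¹⟩`. -/
abbrev GroupU6 (n : ℕ) : Type :=
  PresentedGroup ({genX ^ (2 * n), genY ^ 3, (genX⁻¹ * genY * genX) * (genY⁻¹)⁻¹} :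
    Set (FreeGroup (Fin 2)))

/-- The semidihedral group `SD_{8n} = ⟨x, y : x ^ (4n) = y ^ 2 = 1, y x y = x ^ (2n - 1)⟩`; here
`n` is positive. -/
abbrev GroupSD (n : ℕ) : Type :=
  PresentedGroup ({genX ^ (4 * n), genY ^ 2, (genY * genX * genY) * (genX ^ (2 * n - 1))⁻¹} :
    Set (FreeGroup (Fin 2)))

/-- A group generated by two elements `a`, `b` of finite order such that conjugation by `a` maps `b`
to a power of `b` is finite. -/
theorem finite_of_generators {G : Type*} [Group G] (a b : G) {N M : ℕ} (hN : 0 < N) (hM : 0 < M)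
    (ha : a ^ N = 1) (hb : b ^ M = 1) (k : ℤ) (hab : a⁻¹ * b * a = b ^ k)
    (hgen : Subgroup.closure {a, b} = ⊤) : Finite G := by
  let S : Set G := {g | ∃ i j : ℤ, g = a ^ i * b ^ j}
  have hfa : (Subgroup.zpowers a : Set G).Finite :=
    (isOfFinOrder_iff_pow_eq_one.mpr ⟨N, hN, ha⟩).finite_zpowers
  have hfb : (Subgroup.zpowers b : Set G).Finite :=
    (isOfFinOrder_iff_pow_eq_one.mpr ⟨M, hM, hb⟩).finite_zpowers
  have hS : S.Finite := by
    refine (Set.Finite.image2 (fun x y => x * y) hfa hfb).subset ?_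
    rintro g ⟨i, j, rfl⟩
    exact ⟨a ^ i, ⟨i, rfl⟩, b ^ j, ⟨j, rfl⟩, rfl⟩
  have hmap : ∀ g ∈ S, g * a ∈ S := by
    rintro g ⟨i, j, rfl⟩
    refine ⟨i + 1, k * j, ?_⟩
    have h : a⁻¹ * b ^ j * a = b ^ (k * j) := by
      rw [zpow_mul, ← hab]
      have := (map_zpow (MulAut.conj a⁻¹) b j)
      simpa [MulAut.conj_apply] using this
    rw [← h, zpow_add, zpow_one]
    group
  have ha' : a⁻¹ = a ^ (N - 1) := by
    rw [inv_eq_iff_mul_eq_one, ← pow_succ', Nat.sub_add_cancel hN, ha]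
  have hpow : ∀ (t : ℕ), ∀ g ∈ S, g * a ^ t ∈ S := by
    intro t
    induction t with
    | zero => intro g hg; simpa using hg
    | succ t ih => intro g hg; rw [pow_succ, ← mul_assoc]; exact hmap _ (ih g hg)
  have hall : ∀ g : G, g ∈ S := by
    intro g
    have hg : g ∈ Subgroup.closure {a, b} := hgen ▸ Subgroup.mem_top g
    induction hg using Subgroup.closure_induction_right with
    | one => exact ⟨0, 0, by simp⟩
    | mul_right x _ y hy hx =>
      rcases hy with rfl | hy
      · exact hmap _ hx
      · obtain ⟨i, j, rfl⟩ := hx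
        rw [Set.mem_singleton_iff.mp hy]
        exact ⟨i, j + 1, by rw [zpow_add, zpow_one, mul_assoc]⟩
    | mul_inv_cancel x _ y hy hx =>
      rcases hy with rfl | hy
      · rw [ha']; exact hpow _ _ hx
      · obtain ⟨i, j, rfl⟩ := hx
        rw [Set.mem_singleton_iff.mp hy]
        exact ⟨i, j - 1, by rw [zpow_sub, zpow_one, mul_assoc]⟩
  exact Set.finite_univ_iff.mp (hS.subset fun g _ => hall g)

theorem closure_generators (rels : Set (FreeGroup (Fin 2))) :
    Subgroup.closure {PresentedGroup.mk rels genX, PresentedGroup.mk rels genY} = ⊤ := by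
  rw [← PresentedGroup.closure_range_of rels]
  congr 1
  ext g
  simp only [Set.mem_insert_iff, Set.mem_singleton_iff, Set.mem_range, Fin.exists_fin_two]
  exact ⟨fun h => h.imp Eq.symm Eq.symm, fun h => h.imp Eq.symm Eq.symm⟩

instance finiteGroupU (n m : ℕ) [NeZero n] [NeZero m] : Finite (GroupU n m) := by
  refine finite_of_generators (N := 2 * n) (M := m) _ _ (by have := NeZero.pos n; omega)
    (NeZero.pos m) ?_ ?_ (-1) ?_ (closure_generators _)
  · rw [← map_pow]; exact PresentedGroup.one_of_mem (by simp)
  · rw [← map_pow]; exact PresentedGroup.one_of_mem (by simp)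
  · rw [zpow_neg, zpow_one, ← map_inv, ← map_inv, ← map_mul, ← map_mul]
    exact PresentedGroup.mk_eq_mk_of_mul_inv_mem (by simp)

instance finiteGroupU6 (n : ℕ) [NeZero n] : Finite (GroupU6 n) :=
  finiteGroupU n 3

instance finiteGroupSD (n : ℕ) [NeZero n] : Finite (GroupSD n) := by
  have hn := NeZero.pos n
  have key : ∀ r : Set (FreeGroup (Fin 2)), genX ^ (4 * n) ∈ r → genY ^ 2 ∈ r →
      (genY * genX * genY) * (genX ^ (2 * n - 1))⁻¹ ∈ r → Finite (PresentedGroup r) := by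
    intro r h1 h2 h3
    have hy : PresentedGroup.mk r genY ^ 2 = 1 := by
      rw [← map_pow]; exact PresentedGroup.one_of_mem h2
    refine finite_of_generators (N := 2) (M := 4 * n) (PresentedGroup.mk r genY)
      (PresentedGroup.mk r genX) (by omega) (by omega) hy ?_ ((2 * n - 1 : ℕ) : ℤ) ?_
      (by rw [Set.pair_comm]; exact closure_generators _)
    · rw [← map_pow]; exact PresentedGroup.one_of_mem h1
    · have h4 : PresentedGroup.mk r genY * PresentedGroup.mk r genY = 1 := by rw [← sq, hy]
      rw [inv_eq_of_mul_eq_one_right h4, zpow_natCast, ← map_pow, ← map_mul, ← map_mul]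
      exact PresentedGroup.mk_eq_mk_of_mul_inv_mem h3
  exact key _ (by simp) (by simp) (by simp)

end Group

end CCC

/-!
Each of the groups has an abelian subgroup `A` of index two, on which the elements outside `A` act
by an involution `σ`. The classes of the elements of `A` not fixed by `σ` form one clique `K_a`.
The classes outside `A` correspond to the cosets of the image of `σ - 1`, and two of them are
adjacent exactly when they agree modulo the kernel and the image of `σ - 1`. Thus
`Γ_G = K_a ⊔ k K_b`, where `2a + kb = |A|`, `kb` is the index of the image and `k` that of the sum
of the kernel and the image.

For such a graph the common neighbourhood matrices are block diagonal with blocks of the form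
`α I + β J`, so that the spectra are explicit. When `a` dominates `b` and `kb`, the signs of all
deviations from the mean are known and the comparison with the complete graph is decided by the sign
of a polynomial in `a`, `b` and `kb`.
-/

namespace CCC

/-! ### Disjoint unions of complete graphs -/

section ClusterGraph

variable {V ι : Type*}

/-- The disjoint union of the complete graphs on the fibres of `f`. -/
def clusterGraph (f : V → ι) : SimpleGraph V where
  Adj u v := u ≠ v ∧ f u = f v
  symm := ⟨fun _ _ h => ⟨h.1.symm, h.2.symm⟩⟩
  loopless := ⟨fun _ h => h.1 rfl⟩

/-- The number of vertices of the complete graph on the fibre over `i` in `clusterGraph f`; this is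
`0` when the fibre is empty. -/
noncomputable def cliqueSize (f : V → ι) (i : ι) : ℕ :=
  Nat.card {v // f v = i}

theorem commonNeighbors_clusterGraph_eq_empty (f : V → ι) {u v : V} (hf : f u ≠ f v) :
    (clusterGraph f).commonNeighbors u v = ∅ :=
  Set.eq_empty_of_forall_notMem fun _ ⟨hu, hv⟩ =>
    hf ((And.right hu).trans (And.right hv).symm)

open Classical in
theorem cliqueSize_eq_card_filter [Fintype V] (f : V → ι) (i : ι) :
    cliqueSize f i = (Finset.univ.filter fun v => f v = i).card :=
  Nat.subtype_card _ (by simp)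

theorem ncard_commonNeighbors_clusterGraph [Finite V] (f : V → ι) {u v : V} (huv : u ≠ v)
    (hf : f u = f v) :
    (((clusterGraph f).commonNeighbors u v).ncard : ℝ) = cliqueSize f (f u) - 2 := by
  classical
  have := Fintype.ofFinite V
  have hsub : ({u, v} : Finset V) ⊆ Finset.univ.filter fun w => f w = f u := by
    simp [Finset.insert_subset_iff, hf]
  have hcommon : (clusterGraph f).commonNeighbors u v =
      ((Finset.univ.filter fun w => f w = f u) \ {u, v} : Finset V) := by
    ext w
    simp only [SimpleGraph.mem_commonNeighbors, clusterGraph, Finset.coe_sdiff, Set.mem_sdiff,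
      Finset.mem_coe, Finset.mem_filter, Finset.mem_univ, true_and, Finset.mem_insert,
      Finset.mem_singleton]
    grind
  rw [hcommon, Set.ncard_coe_finset, Finset.card_sdiff_of_subset hsub,
    Nat.cast_sub (Finset.card_le_card hsub), Finset.card_pair huv, cliqueSize_eq_card_filter,
    Nat.cast_ofNat]

open Classical in
theorem cnMatrix_clusterGraph [Finite V] (f : V → ι) :
    cnMatrix (clusterGraph f) = Matrix.of fun u v => if f u = f v then
      (if u = v then 0 else (cliqueSize f (f u) : ℝ) - 2) else 0 := by
  ext u v
  simp only [cnMatrix, Matrix.of_apply]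
  by_cases huv : u = v
  · simp [huv]
  by_cases hf : f u = f v
  · simp only [huv, hf, if_true, if_false]
    rw [ncard_commonNeighbors_clusterGraph f huv hf, hf]
  · simp [huv, hf, commonNeighbors_clusterGraph_eq_empty f hf]

variable [Fintype V]

open Classical in
theorem deviation_scalar_add_const (α β c : ℝ) :
    deviation (Matrix.of fun i j : V => if i = j then α + β else β) c =
      ((Fintype.card V : ℝ) - 1) * |α - c| + |α + Fintype.card V * β - c| := by
  rcases isEmpty_or_nonempty V with hV | hV
  · simp [deviation, spectrumMultiset]
  · have hpos : 1 ≤ Fintype.card V := Fintype.card_pos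
    rw [deviation, spectrumMultiset_const_add_scalar]
    simp [Nat.cast_sub hpos]

open Classical in
theorem deviation_eq_sum_toSquareBlock [Fintype ι] (f : V → ι) (M : Matrix V V ℝ)
    (hM : ∀ u v, f u ≠ f v → M u v = 0) (c : ℝ) :
    deviation M c = ∑ i, deviation (M.toSquareBlock f i) c := by
  let : LinearOrder ι := linearOrderOfSTO WellOrderingRel
  have hblocks : M.BlockTriangular f := fun u v huv => hM u v huv.ne'
  have hchar : M.charpoly = ∏ i, (M.toSquareBlock f i).charpoly := by
    rw [hblocks.charpoly]
    convert Finset.prod_subset (Finset.subset_univ _) fun i _ hi => ?_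
    have : IsEmpty {v // f v = i} :=
      ⟨fun v => hi (Finset.mem_image.mpr ⟨v, Finset.mem_univ _, v.2⟩)⟩
    exact Matrix.charpoly_isEmpty
  simp only [deviation, spectrumMultiset]
  rw [hchar, Polynomial.roots_prod _ _
    (Finset.prod_ne_zero_iff.mpr fun i _ => (Matrix.charpoly_monic _).ne_zero),
    Multiset.map_bind, Multiset.sum_bind]
  simp only [Finset.sum]
  congr!

theorem sum_comp_eq_sum_cliqueSize_mul [Fintype ι] (f : V → ι) (g : ι → ℝ) :
    ∑ v, g (f v) = ∑ i, cliqueSize f i * g i := by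
  classical
  rw [← Finset.sum_fiberwise (g := f)]
  refine Finset.sum_congr rfl fun i _ => ?_
  rw [cliqueSize_eq_card_filter, ← nsmul_eq_mul, ← Finset.sum_const]
  exact Finset.sum_congr rfl fun v hv => by rw [(Finset.mem_filter.mp hv).2]

theorem card_eq_sum_cliqueSize [Fintype ι] (f : V → ι) :
    (Fintype.card V : ℝ) = ∑ i, (cliqueSize f i : ℝ) := by
  simpa using sum_comp_eq_sum_cliqueSize_mul f fun _ => 1

open Classical in
theorem deviation_of_fiberwise_scalar_add_const [Fintype ι] (f : V → ι) (α β : ι → ℝ) (c : ℝ) :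
    deviation (Matrix.of fun u v : V =>
      if f u = f v then (if u = v then α (f u) + β (f u) else β (f u)) else 0) c =
      ∑ i, (((cliqueSize f i : ℝ) - 1) * |α i - c| + |α i + cliqueSize f i * β i - c|) := by
  rw [deviation_eq_sum_toSquareBlock f _ (fun u v huv => by simp [huv])]
  refine Finset.sum_congr rfl fun i _ => ?_
  rw [cliqueSize, Nat.card_eq_fintype_card, ← deviation_scalar_add_const]
  congr 1
  ext ⟨u, rfl⟩ ⟨v, hv⟩
  simp [Matrix.toSquareBlock_def, hv, Subtype.ext_iff]

open Classical in
theorem cnrsMatrix_clusterGraph (f : V → ι) :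
    cnrsMatrix (clusterGraph f) = Matrix.diagonal fun v =>
      ((cliqueSize f (f v) : ℝ) - 1) * ((cliqueSize f (f v) : ℝ) - 2) := by
  unfold cnrsMatrix
  congr 1
  funext u
  have hentry : ∀ v, cnMatrix (clusterGraph f) u v =
      (if f v = f u then (cliqueSize f (f u) : ℝ) - 2 else 0) -
        (if u = v then (cliqueSize f (f u) : ℝ) - 2 else 0) := by
    intro v
    rw [cnMatrix_clusterGraph]
    by_cases huv : u = v
    · simp [huv]
    · simp [huv, eq_comm]
  simp only [hentry, Finset.sum_sub_distrib, Finset.sum_ite_eq, Finset.mem_univ, if_true,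
    ← Finset.sum_filter, Finset.sum_const, nsmul_eq_mul, ← cliqueSize_eq_card_filter]
  ring

theorem cnMean_clusterGraph [Fintype ι] (f : V → ι) :
    cnMean (clusterGraph f) =
      (∑ i, (cliqueSize f i : ℝ) * ((cliqueSize f i - 1) * (cliqueSize f i - 2))) /
        ∑ i, (cliqueSize f i : ℝ) := by
  classical
  rw [cnMean, ← card_eq_sum_cliqueSize, cnrsMatrix_clusterGraph, Matrix.trace_diagonal,
    sum_comp_eq_sum_cliqueSize_mul f fun i => ((cliqueSize f i : ℝ) - 1) * (cliqueSize f i - 2)]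

theorem cnlEnergy_clusterGraph [Fintype ι] (f : V → ι) :
    cnlEnergy (clusterGraph f) = ∑ i, (((cliqueSize f i : ℝ) - 1) *
      |cliqueSize f i * ((cliqueSize f i : ℝ) - 2) - cnMean (clusterGraph f)| +
        |cnMean (clusterGraph f)|) := by
  classical
  have hmatrix : cnlMatrix (clusterGraph f) = Matrix.of fun u v : V => if f u = f v then
      (if u = v then (cliqueSize f (f u) : ℝ) * ((cliqueSize f (f u) : ℝ) - 2) +
        -((cliqueSize f (f u) : ℝ) - 2) else -((cliqueSize f (f u) : ℝ) - 2)) else 0 := by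
    rw [cnlMatrix, cnrsMatrix_clusterGraph, cnMatrix_clusterGraph]
    ext u v
    by_cases huv : u = v
    · subst huv
      simp only [Matrix.sub_apply, Matrix.diagonal_apply_eq, Matrix.of_apply, if_true]
      ring
    · by_cases hf : f u = f v <;> simp [huv, hf]
  rw [cnlEnergy, hmatrix, deviation_of_fiberwise_scalar_add_const f
    (fun i => (cliqueSize f i : ℝ) * ((cliqueSize f i : ℝ) - 2))
    (fun i => -((cliqueSize f i : ℝ) - 2))]
  refine Finset.sum_congr rfl fun i _ => ?_
  congr 1
  rw [← abs_neg (cnMean _)]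
  congr 1
  ring

theorem cnslEnergy_clusterGraph [Fintype ι] (f : V → ι) :
    cnslEnergy (clusterGraph f) = ∑ i, (((cliqueSize f i : ℝ) - 1) *
      |((cliqueSize f i : ℝ) - 2) ^ 2 - cnMean (clusterGraph f)| +
        |2 * ((cliqueSize f i : ℝ) - 1) * ((cliqueSize f i : ℝ) - 2) -
          cnMean (clusterGraph f)|) := by
  classical
  have hmatrix : cnslMatrix (clusterGraph f) = Matrix.of fun u v : V => if f u = f v then
      (if u = v then ((cliqueSize f (f u) : ℝ) - 2) ^ 2 + ((cliqueSize f (f u) : ℝ) - 2)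
        else (cliqueSize f (f u) : ℝ) - 2) else 0 := by
    rw [cnslMatrix, cnrsMatrix_clusterGraph, cnMatrix_clusterGraph]
    ext u v
    by_cases huv : u = v
    · subst huv
      simp only [Matrix.add_apply, Matrix.diagonal_apply_eq, Matrix.of_apply, if_true]
      ring
    · by_cases hf : f u = f v <;> simp [huv, hf]
  rw [cnslEnergy, hmatrix, deviation_of_fiberwise_scalar_add_const f
    (fun i => ((cliqueSize f i : ℝ) - 2) ^ 2) (fun i => (cliqueSize f i : ℝ) - 2)]
  refine Finset.sum_congr rfl fun i _ => ?_
  congr 2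
  ring

end ClusterGraph

section CliqueUnion

/-- The number `Δ` of the graph `K_a ⊔ k K_b`, where `s = k b`. -/
noncomputable def cliqueMean (a b s : ℝ) : ℝ :=
  (a * ((a - 1) * (a - 2)) + s * ((b - 1) * (b - 2))) / (a + s)

/-- Half of `|K_a ⊔ k K_b|` times the excess of the CNL-energy of `K_a ⊔ k K_b` over that of the
complete graph, divided by `s = k b`; this closed form is valid when `a` dominates `b` and `s`. -/
def cnlExcess (a b s : ℝ) : ℝ :=
  (a - 1) * (a * (a - 2) - (b - 1) * (b - 2)) - 3 * a * (a - 1) - 3 * a * (s - 1) -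
    (s - 1) * (s - 2)

/-- Half of `|K_a ⊔ k K_b|` times the excess of the CNSL-energy of `K_a ⊔ k K_b` over that of the
complete graph, where `s = k b`; this closed form is valid when `a` dominates `b` and `s`. -/
def cnslExcess (a b s : ℝ) : ℝ :=
  a * s * (a - b) * (a + b - 3) - (a + s) * (a + s - 1) * (a + s - 2)

section Real

variable {a b s : ℝ}

theorem add_mul_cliqueMean (hN : 0 < a + s) :
    (a + s) * cliqueMean a b s = a * ((a - 1) * (a - 2)) + s * ((b - 1) * (b - 2)) :=
  mul_div_cancel₀ _ hN.ne'

theorem cliqueMean_nonneg (hb : 0 ≤ (b - 1) * (b - 2)) (ha : 0 ≤ (a - 1) * (a - 2))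
    (ha0 : 0 ≤ a) (hs : 0 ≤ s) : 0 ≤ cliqueMean a b s := by
  unfold cliqueMean
  positivity

theorem mul_sub_two_le_cliqueMean (hb : 1 ≤ b) (hba : b + 1 ≤ a) (hs : 0 ≤ s) (hsa : s ≤ a) :
    b * (b - 2) ≤ cliqueMean a b s := by
  rw [cliqueMean, le_div_iff₀ (by linarith)]
  have hsquare : b * (b - 1) ≤ (a - 1) * (a - 2) := by nlinarith
  nlinarith [mul_le_mul_of_nonneg_left hsquare (by linarith : 0 ≤ a)]

theorem cliqueMean_le_mul_sub_two (hb : 1 ≤ b) (hba : b + 1 ≤ a) (hs : 0 ≤ s) :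
    cliqueMean a b s ≤ a * (a - 2) := by
  rw [cliqueMean, div_le_iff₀ (by linarith)]
  have hsquare : (b - 1) * (b - 2) ≤ a * (a - 2) := by nlinarith
  nlinarith [mul_le_mul_of_nonneg_left hsquare hs]

theorem two_mul_sub_one_mul_sub_two_le_cliqueMean (hb : 1 ≤ b) (hb2 : 0 ≤ (b - 1) * (b - 2))
    (hba : 2 * b ≤ a) (hs : 0 ≤ s) (hsa : s ≤ a) :
    2 * (b - 1) * (b - 2) ≤ cliqueMean a b s := by
  rw [cliqueMean, le_div_iff₀ (by linarith)]
  have hsquare : 4 * ((b - 1) * (b - 2)) ≤ (a - 1) * (a - 2) := by nlinarith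
  nlinarith [mul_le_mul_of_nonneg_left hsquare (by linarith : 0 ≤ a),
    mul_le_mul_of_nonneg_right hsa hb2]

theorem cliqueMean_le_sub_two_sq (hb : 1 ≤ b) (hba : 2 * b ≤ a) (ha : 4 ≤ a) (hs : 2 ≤ s) :
    cliqueMean a b s ≤ (a - 2) ^ 2 := by
  rw [cliqueMean, div_le_iff₀ (by linarith)]
  have hsquare : 4 * ((b - 1) * (b - 2)) ≤ (a - 2) * (a - 4) := by nlinarith
  have hlarge : a * (a - 2) ≤ s * ((a - 2) ^ 2 - (a - 2) * (a - 4) / 4) := by nlinarith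
  nlinarith [mul_le_mul_of_nonneg_left hsquare (by linarith : 0 ≤ s)]

end Real

variable {V : Type*}

/-- `G` is the disjoint union `K_a ⊔ k K_b`: the labelling sends the vertices of `K_a` to `none`
and those of the copies of `K_b` to `some i`. -/
def IsCliqueUnion (G : SimpleGraph V) (k a b : ℕ) : Prop :=
  ∃ f : V → Option (Fin k), G = clusterGraph f ∧ cliqueSize f none = a ∧
    ∀ i, cliqueSize f (some i) = b

theorem IsCliqueUnion.of_iso {W : Type*} {G : SimpleGraph V} {H : SimpleGraph W} {k a b : ℕ}
    (h : IsCliqueUnion G k a b) (e : H ≃g G) : IsCliqueUnion H k a b := by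
  obtain ⟨f, rfl, ha, hb⟩ := h
  have hsize (i) : cliqueSize (f ∘ e) i = cliqueSize f i :=
    Nat.card_congr (e.toEquiv.subtypeEquiv fun _ => Iff.rfl)
  refine ⟨f ∘ e, ?_, (hsize none).trans ha, fun i => (hsize (some i)).trans (hb i)⟩
  ext u v
  rw [← e.map_adj_iff]
  exact and_congr e.injective.ne_iff Iff.rfl

theorem isCliqueUnion_clusterGraph {ι : Type*} [Finite ι] (f : V → Option ι) {b : ℕ}
    (hb : ∀ i, cliqueSize f (some i) = b) :
    IsCliqueUnion (clusterGraph f) (Nat.card ι) (cliqueSize f none) b := by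
  let e : Option ι ≃ Option (Fin (Nat.card ι)) := (Finite.equivFin ι).optionCongr
  have hsize (i) : cliqueSize (e ∘ f) (e i) = cliqueSize f i :=
    Nat.card_congr (Equiv.subtypeEquivRight fun _ => e.apply_eq_iff_eq)
  refine ⟨e ∘ f, ?_, hsize none, fun i => ?_⟩
  · ext u v
    exact and_congr_right fun _ => e.apply_eq_iff_eq.symm
  · obtain ⟨i, rfl⟩ := (Finite.equivFin ι).surjective i
    exact (hsize (some i)).trans (hb i)

variable {G : SimpleGraph V} {k a b : ℕ}

theorem IsCliqueUnion.nonempty (h : IsCliqueUnion G k a b) (ha : 1 ≤ a) : Nonempty V := by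
  obtain ⟨f, -, hf, -⟩ := h
  exact (Nat.card_pos_iff.mp (ha.trans_eq hf.symm)).1.map Subtype.val

variable [Fintype V]

theorem IsCliqueUnion.card_eq (h : IsCliqueUnion G k a b) : (Fintype.card V : ℝ) = a + k * b := by
  obtain ⟨f, -, rfl, hb⟩ := h
  simp [card_eq_sum_cliqueSize f, Fintype.sum_option, hb]

theorem IsCliqueUnion.cnMean_eq (h : IsCliqueUnion G k a b) :
    cnMean G = cliqueMean a b (k * b) := by
  obtain ⟨f, rfl, rfl, hb⟩ := h
  rw [cnMean_clusterGraph, cliqueMean]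
  simp only [Fintype.sum_option, hb, Finset.sum_const, Finset.card_univ, Fintype.card_fin,
    nsmul_eq_mul, mul_assoc]

theorem IsCliqueUnion.cnlEnergy_eq (h : IsCliqueUnion G k a b) :
    cnlEnergy G =
      ((a - 1) * |a * (a - 2) - cliqueMean a b (k * b)| + |cliqueMean a b (k * b)|) +
      k * ((b - 1) * |b * (b - 2) - cliqueMean a b (k * b)| + |cliqueMean a b (k * b)|) := by
  rw [← h.cnMean_eq]
  obtain ⟨f, rfl, rfl, hb⟩ := h
  simp only [cnlEnergy_clusterGraph, Fintype.sum_option, hb, Finset.sum_const, Finset.card_univ,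
    Fintype.card_fin, nsmul_eq_mul]

theorem IsCliqueUnion.cnslEnergy_eq (h : IsCliqueUnion G k a b) :
    cnslEnergy G =
      ((a - 1) * |((a : ℝ) - 2) ^ 2 - cliqueMean a b (k * b)| +
        |2 * (a - 1) * (a - 2) - cliqueMean a b (k * b)|) +
      k * ((b - 1) * |((b : ℝ) - 2) ^ 2 - cliqueMean a b (k * b)| +
        |2 * (b - 1) * (b - 2) - cliqueMean a b (k * b)|) := by
  rw [← h.cnMean_eq]
  obtain ⟨f, rfl, rfl, hb⟩ := h
  simp only [cnslEnergy_clusterGraph, Fintype.sum_option, hb, Finset.sum_const, Finset.card_univ,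
    Fintype.card_fin, nsmul_eq_mul]

theorem IsCliqueUnion.cnlEnergy_top_eq (h : IsCliqueUnion G k a b) (ha : 1 ≤ a) :
    cnlEnergy (⊤ : SimpleGraph V) = 2 * ((a + k * b : ℝ) - 1) * ((a + k * b : ℝ) - 2) := by
  have := h.nonempty ha
  rw [cnlEnergy_top, h.card_eq]

theorem IsCliqueUnion.cnslEnergy_top_eq (h : IsCliqueUnion G k a b) (ha : 1 ≤ a) :
    cnslEnergy (⊤ : SimpleGraph V) = 2 * ((a + k * b : ℝ) - 1) * ((a + k * b : ℝ) - 2) := by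
  have := h.nonempty ha
  rw [cnslEnergy_top, h.card_eq]

theorem natCast_sub_one_mul_sub_two_nonneg (n : ℕ) (hn : 1 ≤ n) :
    0 ≤ ((n : ℝ) - 1) * ((n : ℝ) - 2) := by
  obtain rfl | h2 : n = 1 ∨ 2 ≤ n := by omega
  · norm_num
  · have : (2 : ℝ) ≤ n := mod_cast h2
    exact mul_nonneg (by linarith) (by linarith)

theorem IsCliqueUnion.card_mul_cnlEnergy_sub_top (h : IsCliqueUnion G k a b) (hb : 1 ≤ b)
    (hba : b + 1 ≤ a) (hsa : k * b ≤ a) :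
    (a + k * b : ℝ) * (cnlEnergy G - cnlEnergy (⊤ : SimpleGraph V)) =
      2 * (k * b) * cnlExcess a b (k * b) := by
  have hb' : (1 : ℝ) ≤ b := mod_cast hb
  have hba' : (b : ℝ) + 1 ≤ a := mod_cast hba
  have hsa' : (k * b : ℝ) ≤ a := mod_cast hsa
  have hs : (0 : ℝ) ≤ k * b := by positivity
  have hmean := add_mul_cliqueMean (a := a) (b := b) (s := k * b) (by linarith)
  rw [h.cnlEnergy_eq, h.cnlEnergy_top_eq (by omega),
    abs_of_nonneg (cliqueMean_nonneg (natCast_sub_one_mul_sub_two_nonneg b hb)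
      (natCast_sub_one_mul_sub_two_nonneg a (by omega)) (by linarith) hs),
    abs_of_nonneg (sub_nonneg.mpr (cliqueMean_le_mul_sub_two hb' hba' hs)),
    abs_of_nonpos (sub_nonpos.mpr (mul_sub_two_le_cliqueMean hb' hba' hs hsa')), cnlExcess]
  linear_combination (k * (b : ℝ) - a + 2) * hmean

theorem IsCliqueUnion.card_mul_cnslEnergy_sub_top (h : IsCliqueUnion G k a b) (hb : 1 ≤ b)
    (hba : 2 * b ≤ a) (ha : 4 ≤ a) (hs : 2 ≤ k * b) (hsa : k * b ≤ a) :
    (a + k * b : ℝ) * (cnslEnergy G - cnslEnergy (⊤ : SimpleGraph V)) =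
      2 * cnslExcess a b (k * b) := by
  have hb' : (1 : ℝ) ≤ b := mod_cast hb
  have hba' : (2 : ℝ) * b ≤ a := mod_cast hba
  have ha' : (4 : ℝ) ≤ a := mod_cast ha
  have hs' : (2 : ℝ) ≤ k * b := mod_cast hs
  have hsa' : (k * b : ℝ) ≤ a := mod_cast hsa
  have hmean := add_mul_cliqueMean (a := a) (b := b) (s := k * b) (by linarith)
  have hlarge := cliqueMean_le_sub_two_sq hb' hba' ha' hs'
  have hsmall := two_mul_sub_one_mul_sub_two_le_cliqueMean hb'
    (natCast_sub_one_mul_sub_two_nonneg b hb) hba' (by linarith) hsa'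
  have hsmall_sq : ((b : ℝ) - 1) * |((b : ℝ) - 2) ^ 2 - cliqueMean a b (k * b)| =
      (b - 1) * (cliqueMean a b (k * b) - ((b : ℝ) - 2) ^ 2) := by
    obtain rfl | hb2 : b = 1 ∨ 2 ≤ b := by omega
    · norm_num
    · have : (2 : ℝ) ≤ b := mod_cast hb2
      rw [abs_of_nonpos (by nlinarith), neg_sub]
  rw [h.cnslEnergy_eq, h.cnslEnergy_top_eq (by omega), hsmall_sq,
    abs_of_nonneg (sub_nonneg.mpr hlarge), abs_of_nonneg (by nlinarith),
    abs_of_nonpos (sub_nonpos.mpr hsmall), cnslExcess]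
  linear_combination (k * (b : ℝ) - a) * hmean

end CliqueUnion

section Comparison

variable {V : Type*} [Fintype V] {G : SimpleGraph V} {k a b q : ℕ} {P Q : Prop}

/-- Neither energy of `G` equals that of the complete graph on the same vertices; the CNL-energy is
larger exactly when `P` holds, the CNSL-energy exactly when `Q` holds. -/
structure StrictComparison (G : SimpleGraph V) (P Q : Prop) : Prop where
  not_cnlBorder : ¬ IsCNLBorderenergetic G
  cnlHyper_iff : IsCNLHyperenergetic G ↔ P
  not_cnslBorder : ¬ IsCNSLBorderenergetic G
  cnslHyper_iff : IsCNSLHyperenergetic G ↔ Q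

theorem StrictComparison.congr {P' Q' : Prop} (h : StrictComparison G P Q) (hP : P ↔ P')
    (hQ : Q ↔ Q') : StrictComparison G P' Q' := by
  rwa [← hP, ← hQ]

theorem StrictComparison.of_lt (hcnl : cnlEnergy G < cnlEnergy (⊤ : SimpleGraph V))
    (hcnsl : cnslEnergy G < cnslEnergy (⊤ : SimpleGraph V)) (hP : ¬ P) (hQ : ¬ Q) :
    StrictComparison G P Q :=
  ⟨hcnl.ne, iff_of_false hcnl.not_gt hP, hcnsl.ne, iff_of_false hcnsl.not_gt hQ⟩

theorem eq_iff_and_lt_iff_of_mul_sub_eq {N c x y z : ℝ} (hN : 0 < N) (hc : 0 < c)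
    (h : N * (y - x) = c * z) : (y = x ↔ z = 0) ∧ (x < y ↔ 0 < z) := by
  constructor
  · rw [← sub_eq_zero, ← mul_eq_zero_iff_left hN.ne', h, mul_eq_zero_iff_left hc.ne']
  · rw [← sub_pos, ← mul_pos_iff_of_pos_left hN, h, mul_pos_iff_of_pos_left hc]

theorem ne_zero_and_pos_iff {z : ℝ} (hpos : P → 0 < z) (hneg : ¬ P → z < 0) :
    z ≠ 0 ∧ (0 < z ↔ P) := by
  by_cases hP : P
  · exact ⟨(hpos hP).ne', iff_of_true (hpos hP) hP⟩
  · exact ⟨(hneg hP).ne, iff_of_false (hneg hP).not_gt hP⟩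

theorem IsCliqueUnion.cnl_border_iff_and_hyper_iff (h : IsCliqueUnion G k a b) (hk : 1 ≤ k)
    (hb : 1 ≤ b) (hba : b + 1 ≤ a) (hsa : k * b ≤ a) :
    (IsCNLBorderenergetic G ↔ cnlExcess a b (k * b) = 0) ∧
      (IsCNLHyperenergetic G ↔ 0 < cnlExcess a b (k * b)) :=
  eq_iff_and_lt_iff_of_mul_sub_eq (by positivity) (by positivity)
    (h.card_mul_cnlEnergy_sub_top hb hba hsa)

theorem IsCliqueUnion.cnsl_border_iff_and_hyper_iff (h : IsCliqueUnion G k a b) (hb : 1 ≤ b)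
    (hba : 2 * b ≤ a) (ha : 4 ≤ a) (hs : 2 ≤ k * b) (hsa : k * b ≤ a) :
    (IsCNSLBorderenergetic G ↔ cnslExcess a b (k * b) = 0) ∧
      (IsCNSLHyperenergetic G ↔ 0 < cnslExcess a b (k * b)) :=
  eq_iff_and_lt_iff_of_mul_sub_eq (by positivity) two_pos
    (h.card_mul_cnslEnergy_sub_top hb hba ha hs hsa)

theorem cliqueMean_self {x s : ℝ} (hN : 0 < x + s) : cliqueMean x x s = (x - 1) * (x - 2) := by
  rw [cliqueMean, ← add_mul, mul_div_cancel_left₀ _ hN.ne']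

theorem IsCliqueUnion.energies_of_eq (h : IsCliqueUnion G k a a) (ha : 1 ≤ a) :
    cnlEnergy G = 2 * (k + 1) * ((a : ℝ) - 1) * (a - 2) ∧
      cnslEnergy G = 2 * (k + 1) * ((a : ℝ) - 1) * (a - 2) := by
  have hmean := natCast_sub_one_mul_sub_two_nonneg a ha
  have habs := sub_one_mul_abs_sub_two ha
  rw [h.cnlEnergy_eq, h.cnslEnergy_eq, cliqueMean_self (by positivity)]
  have hcnl : (a : ℝ) * (a - 2) - (a - 1) * (a - 2) = a - 2 := by ring
  have hcnsl : ((a : ℝ) - 2) ^ 2 - (a - 1) * (a - 2) = -(a - 2) := by ring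
  have hlast : 2 * ((a : ℝ) - 1) * (a - 2) - (a - 1) * (a - 2) = (a - 1) * (a - 2) := by ring
  rw [hcnl, hcnsl, hlast, abs_neg, habs, abs_of_nonneg hmean]
  constructor <;> ring

theorem IsCliqueUnion.strictComparison_of_eq (h : IsCliqueUnion G k a a) (hka : 2 ≤ k * a)
    (hP : ¬ P) (hQ : ¬ Q) : StrictComparison G P Q := by
  have ha : 1 ≤ a := Nat.pos_of_ne_zero fun ha => by simp [ha] at hka
  have hk : 1 ≤ k := Nat.pos_of_ne_zero fun hk => by simp [hk] at hka
  obtain ⟨hcnl, hcnsl⟩ := h.energies_of_eq ha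
  have hlt : 2 * (k + 1) * ((a : ℝ) - 1) * (a - 2) <
      2 * ((a + k * a : ℝ) - 1) * ((a + k * a : ℝ) - 2) := by
    have ha' : (1 : ℝ) ≤ a := mod_cast ha
    have hka' : (2 : ℝ) ≤ k * a := mod_cast hka
    rw [← sub_pos]
    have hdiff : 2 * ((a + k * a : ℝ) - 1) * ((a + k * a : ℝ) - 2) -
        2 * (k + 1) * ((a : ℝ) - 1) * (a - 2) = 2 * k * (k * a * a + a * a - 2) := by ring
    rw [hdiff]
    have : 0 < k * a * a + a * (a : ℝ) - 2 := by nlinarith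
    positivity
  have hcnl_lt : cnlEnergy G < cnlEnergy (⊤ : SimpleGraph V) := by
    rwa [hcnl, h.cnlEnergy_top_eq ha]
  have hcnsl_lt : cnslEnergy G < cnslEnergy (⊤ : SimpleGraph V) := by
    rwa [hcnsl, h.cnslEnergy_top_eq ha]
  exact .of_lt hcnl_lt hcnsl_lt hP hQ

theorem IsCliqueUnion.strictComparison (h : IsCliqueUnion G k a b) (hb : 1 ≤ b) (hba : 2 * b ≤ a)
    (ha : 4 ≤ a) (hs : 2 ≤ k * b) (hsa : k * b ≤ a)
    (hcnl : cnlExcess a b (k * b) ≠ 0 ∧ (0 < cnlExcess a b (k * b) ↔ P))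
    (hcnsl : cnslExcess a b (k * b) ≠ 0 ∧ (0 < cnslExcess a b (k * b) ↔ Q)) :
    StrictComparison G P Q := by
  have hk : 1 ≤ k := Nat.pos_of_ne_zero fun hk => by simp [hk] at hs
  obtain ⟨hcnl_border, hcnl_hyper⟩ := h.cnl_border_iff_and_hyper_iff hk hb (by omega) hsa
  obtain ⟨hcnsl_border, hcnsl_hyper⟩ := h.cnsl_border_iff_and_hyper_iff hb hba ha hs hsa
  exact ⟨hcnl_border.not.mpr hcnl.1, hcnl_hyper.trans hcnl.2, hcnsl_border.not.mpr hcnsl.1,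
    hcnsl_hyper.trans hcnsl.2⟩

theorem IsCliqueUnion.cnl_of_one_one (h : IsCliqueUnion G 1 a 1) (ha : 2 ≤ a) :
    (IsCNLBorderenergetic G ↔ a = 5) ∧ (IsCNLHyperenergetic G ↔ 6 ≤ a) := by
  obtain ⟨hborder, hhyper⟩ := h.cnl_border_iff_and_hyper_iff le_rfl le_rfl ha (by omega)
  have ha' : (2 : ℝ) ≤ a := mod_cast ha
  have hexcess : cnlExcess a (1 : ℕ) ((1 : ℕ) * (1 : ℕ)) = a * (a - 1) * (a - 5) := by
    unfold cnlExcess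
    push_cast
    ring
  have hpos : (0 : ℝ) < a * (a - 1) := mul_pos (by linarith) (by linarith)
  rw [hborder, hhyper, hexcess, mul_eq_zero_iff_left hpos.ne', mul_pos_iff_of_pos_left hpos,
    sub_eq_zero, sub_pos]
  exact ⟨by norm_cast, by norm_cast⟩

theorem IsCliqueUnion.card_mul_cnslEnergy_sub_top_of_one_one (h : IsCliqueUnion G 1 a 1)
    (ha : 2 ≤ a) : (a + 1 : ℝ) * (cnslEnergy G - cnslEnergy (⊤ : SimpleGraph V)) =
      -(2 * ((a - 1) * (a + 4))) := by
  have ha' : (2 : ℝ) ≤ a := mod_cast ha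
  have hmean := add_mul_cliqueMean (a := a) (b := 1) (s := 1) (by linarith)
  have hnonneg : 0 ≤ cliqueMean a 1 1 :=
    cliqueMean_nonneg (by norm_num) (natCast_sub_one_mul_sub_two_nonneg a (by omega))
      (by linarith) zero_le_one
  have hge : ((a : ℝ) - 2) ^ 2 ≤ cliqueMean a 1 1 := by
    rw [cliqueMean, le_div_iff₀ (by linarith)]
    nlinarith
  have hle : cliqueMean a 1 1 ≤ 2 * (a - 1) * (a - 2) := by
    rw [cliqueMean, div_le_iff₀ (by linarith)]
    nlinarith [mul_nonneg (sub_nonneg.mpr ha') (by linarith : (0 : ℝ) ≤ a - 1)]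
  rw [h.cnslEnergy_eq, h.cnslEnergy_top_eq (by omega)]
  simp only [Nat.cast_one, one_mul, sub_self, zero_mul, mul_zero, zero_add, zero_sub, abs_neg]
  rw [abs_of_nonpos (sub_nonpos.mpr hge), abs_of_nonneg (sub_nonneg.mpr hle),
    abs_of_nonneg hnonneg]
  linear_combination (a - 1 : ℝ) * hmean

theorem IsCliqueUnion.cnslEnergy_lt_top_of_one_one (h : IsCliqueUnion G 1 a 1) (ha : 2 ≤ a) :
    cnslEnergy G < cnslEnergy (⊤ : SimpleGraph V) := by
  have ha' : (2 : ℝ) ≤ a := mod_cast ha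
  have hpos : (0 : ℝ) < (a - 1) * (a + 4) := mul_pos (by linarith) (by linarith)
  refine sub_neg.mp (neg_of_mul_neg_right ?_ (by positivity : (0 : ℝ) ≤ a + 1))
  rw [h.card_mul_cnslEnergy_sub_top_of_one_one ha]
  linarith

theorem IsCliqueUnion.comparison_of_one_one (h : IsCliqueUnion G 1 a 1) (ha : 1 ≤ a) :
    (IsCNLBorderenergetic G ↔ a = 1 ∨ a = 5) ∧ (IsCNLHyperenergetic G ↔ 6 ≤ a) ∧
      (IsCNSLBorderenergetic G ↔ a = 1) ∧ ¬ IsCNSLHyperenergetic G := by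
  obtain rfl | ha2 : a = 1 ∨ 2 ≤ a := by omega
  · obtain ⟨hcnl, hcnsl⟩ := h.energies_of_eq le_rfl
    have hcnl_top := h.cnlEnergy_top_eq le_rfl
    have hcnsl_top := h.cnslEnergy_top_eq le_rfl
    norm_num [IsCNLBorderenergetic, IsCNLHyperenergetic, IsCNSLBorderenergetic,
      IsCNSLHyperenergetic, hcnl, hcnsl, hcnl_top, hcnsl_top]
  · obtain ⟨hborder, hhyper⟩ := h.cnl_of_one_one ha2
    have hlt := h.cnslEnergy_lt_top_of_one_one ha2
    exact ⟨hborder.trans (by omega), hhyper, iff_of_false hlt.ne (by omega), hlt.not_gt⟩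

theorem cnlExcess_two (hb : b = 1 ∨ b = 2) (ha : 1 ≤ a) :
    cnlExcess a b 2 ≠ 0 ∧ (0 < cnlExcess a b 2 ↔ 6 ≤ a) := by
  have hexcess : cnlExcess a b 2 = a * (a * (a - 6) + 2) := by
    obtain rfl | rfl := hb <;> unfold cnlExcess <;> push_cast <;> ring
  have hapos : (0 : ℝ) < a := mod_cast ha
  rw [hexcess, mul_pos_iff_of_pos_left hapos, Ne, mul_eq_zero_iff_left hapos.ne']
  refine ne_zero_and_pos_iff (fun h6 => ?_) fun h6 => ?_
  · have : (6 : ℝ) ≤ a := mod_cast h6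
    nlinarith
  · have : (a : ℝ) ≤ 5 := mod_cast (by omega : a ≤ 5)
    have : (1 : ℝ) ≤ a := mod_cast ha
    nlinarith

theorem cnslExcess_two (hb : b = 1 ∨ b = 2) (ha : 1 ≤ a) :
    cnslExcess a b 2 ≠ 0 ∧ (0 < cnslExcess a b 2 ↔ 9 ≤ a) := by
  have hexcess : cnslExcess a b 2 = a * (a * (a - 9) + 2) := by
    obtain rfl | rfl := hb <;> unfold cnslExcess <;> push_cast <;> ring
  have hapos : (0 : ℝ) < a := mod_cast ha
  rw [hexcess, mul_pos_iff_of_pos_left hapos, Ne, mul_eq_zero_iff_left hapos.ne']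
  refine ne_zero_and_pos_iff (fun h9 => ?_) fun h9 => ?_
  · have : (9 : ℝ) ≤ a := mod_cast h9
    nlinarith
  · have : (a : ℝ) ≤ 8 := mod_cast (by omega : a ≤ 8)
    have : (1 : ℝ) ≤ a := mod_cast ha
    nlinarith

theorem IsCliqueUnion.energies_lt_top_of_two (h : IsCliqueUnion G k a b) (hs : k * b = 2)
    (ha1 : 1 ≤ a) (ha3 : a ≤ 3) :
    cnlEnergy G < cnlEnergy (⊤ : SimpleGraph V) ∧
      cnslEnergy G < cnslEnergy (⊤ : SimpleGraph V) := by
  rw [h.cnlEnergy_eq, h.cnslEnergy_eq, h.cnlEnergy_top_eq ha1, h.cnslEnergy_top_eq ha1]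
  have hb : b ≤ 2 := Nat.le_of_dvd two_pos ⟨k, by linarith⟩
  obtain ⟨rfl, rfl⟩ | ⟨rfl, rfl⟩ : b = 1 ∧ k = 2 ∨ b = 2 ∧ k = 1 := by
    interval_cases b <;> omega
  all_goals
    interval_cases a <;> norm_num [cliqueMean, abs_of_nonneg, abs_of_nonpos]

theorem IsCliqueUnion.strictComparison_of_two (h : IsCliqueUnion G k a b) (hs : k * b = 2)
    (ha : 1 ≤ a) : StrictComparison G (6 ≤ a) (9 ≤ a) := by
  obtain ha3 | ha4 : a ≤ 3 ∨ 4 ≤ a := by omega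
  · obtain ⟨hcnl, hcnsl⟩ := h.energies_lt_top_of_two hs ha ha3
    exact .of_lt hcnl hcnsl (by omega) (by omega)
  · have hb2 : b ≤ 2 := Nat.le_of_dvd two_pos ⟨k, by linarith⟩
    have hb : b = 1 ∨ b = 2 := by interval_cases b <;> omega
    have hs' : (k * b : ℝ) = 2 := mod_cast hs
    exact h.strictComparison (by omega) (by omega) ha4 (by omega) (by omega)
      (hs' ▸ cnlExcess_two hb ha) (hs' ▸ cnslExcess_two hb ha)

variable {n : ℕ}

-- After shifting `q` and `n` by their least values, the excess is a polynomial all of whose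
-- coefficients are positive.
theorem cnlExcess_mul_one_mul (hq : 2 ≤ q) (hn : 2 ≤ n) :
    cnlExcess (q * n : ℕ) n n ≠ 0 ∧ (0 < cnlExcess (q * n : ℕ) n n ↔ ¬ (q = 2 ∧ n ≤ 3)) := by
  refine ne_zero_and_pos_iff (fun hpos => ?_) fun hneg => ?_
  · obtain hq3 | ⟨rfl, hn4⟩ : 3 ≤ q ∨ q = 2 ∧ 4 ≤ n := by omega
    · obtain ⟨u, rfl⟩ := Nat.exists_eq_add_of_le hq3
      obtain ⟨v, rfl⟩ := Nat.exists_eq_add_of_le hn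
      unfold cnlExcess
      push_cast
      ring_nf
      positivity
    · obtain ⟨v, rfl⟩ := Nat.exists_eq_add_of_le hn4
      unfold cnlExcess
      push_cast
      ring_nf
      positivity
  · obtain ⟨rfl, rfl | rfl⟩ : q = 2 ∧ (n = 2 ∨ n = 3) := by omega
    all_goals norm_num [cnlExcess]

theorem cnslExcess_mul_one_mul (hq : 2 ≤ q) (hn : 2 ≤ n) :
    cnslExcess (q * n : ℕ) n n ≠ 0 ∧
      (0 < cnslExcess (q * n : ℕ) n n ↔ ¬ (q = 2 ∧ n ≤ 4 ∨ (q = 3 ∨ q = 4) ∧ n = 2)) := by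
  refine ne_zero_and_pos_iff (fun hpos => ?_) fun hneg => ?_
  · obtain hq5 | ⟨hq3, hn3⟩ | ⟨rfl, hn5⟩ : 5 ≤ q ∨ 3 ≤ q ∧ 3 ≤ n ∨ q = 2 ∧ 5 ≤ n := by omega
    · obtain ⟨u, rfl⟩ := Nat.exists_eq_add_of_le hq5
      obtain ⟨v, rfl⟩ := Nat.exists_eq_add_of_le hn
      unfold cnslExcess
      push_cast
      ring_nf
      positivity
    · obtain ⟨u, rfl⟩ := Nat.exists_eq_add_of_le hq3
      obtain ⟨v, rfl⟩ := Nat.exists_eq_add_of_le hn3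
      unfold cnslExcess
      push_cast
      ring_nf
      positivity
    · obtain ⟨v, rfl⟩ := Nat.exists_eq_add_of_le hn5
      unfold cnslExcess
      push_cast
      ring_nf
      positivity
  · obtain ⟨rfl, rfl | rfl | rfl⟩ | ⟨rfl | rfl, rfl⟩ :
        q = 2 ∧ (n = 2 ∨ n = 3 ∨ n = 4) ∨ (q = 3 ∨ q = 4) ∧ n = 2 := by omega
    all_goals norm_num [cnslExcess]

theorem cnlExcess_mul_two_mul (hq : 3 ≤ q) (hn : 2 ≤ n) :
    cnlExcess (q * n : ℕ) n (2 * n) ≠ 0 ∧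
      (0 < cnlExcess (q * n : ℕ) n (2 * n) ↔ ¬ (q = 3 ∧ n = 2)) := by
  refine ne_zero_and_pos_iff (fun hpos => ?_) fun hneg => ?_
  · obtain hq4 | hn3 : 4 ≤ q ∨ 3 ≤ n := by omega
    · obtain ⟨u, rfl⟩ := Nat.exists_eq_add_of_le hq4
      obtain ⟨v, rfl⟩ := Nat.exists_eq_add_of_le hn
      unfold cnlExcess
      push_cast
      ring_nf
      positivity
    · obtain ⟨u, rfl⟩ := Nat.exists_eq_add_of_le hq
      obtain ⟨v, rfl⟩ := Nat.exists_eq_add_of_le hn3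
      unfold cnlExcess
      push_cast
      ring_nf
      positivity
  · obtain ⟨rfl, rfl⟩ := not_not.mp hneg
    norm_num [cnlExcess]

theorem cnslExcess_mul_two_mul (hq : 3 ≤ q) (hn : 2 ≤ n) :
    cnslExcess (q * n : ℕ) n (2 * n) ≠ 0 ∧
      (0 < cnslExcess (q * n : ℕ) n (2 * n) ↔ ¬ (q = 3 ∧ n = 2)) := by
  refine ne_zero_and_pos_iff (fun hpos => ?_) fun hneg => ?_
  · obtain hq4 | hn3 : 4 ≤ q ∨ 3 ≤ n := by omega
    · obtain ⟨u, rfl⟩ := Nat.exists_eq_add_of_le hq4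
      obtain ⟨v, rfl⟩ := Nat.exists_eq_add_of_le hn
      unfold cnslExcess
      push_cast
      ring_nf
      positivity
    · obtain ⟨u, rfl⟩ := Nat.exists_eq_add_of_le hq
      obtain ⟨v, rfl⟩ := Nat.exists_eq_add_of_le hn3
      unfold cnslExcess
      push_cast
      ring_nf
      positivity
  · obtain ⟨rfl, rfl⟩ := not_not.mp hneg
    norm_num [cnslExcess]

theorem IsCliqueUnion.strictComparison_of_mul_one (h : IsCliqueUnion G 1 (q * n) n) (hq : 1 ≤ q)
    (hn : 2 ≤ n) :
    StrictComparison G (¬ (q = 1 ∨ q = 2 ∧ n ≤ 3))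
      (¬ (q = 1 ∨ q = 2 ∧ n ≤ 4 ∨ (q = 3 ∨ q = 4) ∧ n = 2)) := by
  obtain rfl | hq2 : q = 1 ∨ 2 ≤ q := by omega
  · rw [one_mul] at h
    exact h.strictComparison_of_eq (by omega) (by omega) (by omega)
  · have hqn : 2 * n ≤ q * n := Nat.mul_le_mul_right n hq2
    exact (h.strictComparison (by omega) hqn (by omega) (by omega) (by omega)
      (by simpa only [Nat.cast_one, one_mul] using cnlExcess_mul_one_mul hq2 hn)
      (by simpa only [Nat.cast_one, one_mul] using cnslExcess_mul_one_mul hq2 hn)).congr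
      (by omega) (by omega)

theorem IsCliqueUnion.strictComparison_of_mul_two (h : IsCliqueUnion G 2 (q * n) n)
    (hq : q = 1 ∨ 3 ≤ q) (hn : 2 ≤ n) :
    StrictComparison G (¬ (q = 1 ∨ q = 3 ∧ n = 2)) (¬ (q = 1 ∨ q = 3 ∧ n = 2)) := by
  obtain rfl | hq3 := hq
  · rw [one_mul] at h
    exact h.strictComparison_of_eq (by omega) (by omega) (by omega)
  · have hqn : 3 * n ≤ q * n := Nat.mul_le_mul_right n hq3
    exact (h.strictComparison (by omega) (by omega) (by omega) (by omega) (by omega)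
      (cnlExcess_mul_two_mul hq3 hn) (cnslExcess_mul_two_mul hq3 hn)).congr
      (by omega) (by omega)

end Comparison

/-! ### Extensions of the group of order two by an abelian group -/

/-- An involution `σ` of an abelian group together with a fixed point `c` of it: the data of an
extension of the cyclic group of order two by the abelian group. -/
structure Twist (A : Type*) [AddCommGroup A] where
  σ : A →+ A
  c : A
  σ_σ : ∀ a, σ (σ a) = a
  σ_c : σ c = c

/-- The extension of the abelian group `A` by an element `ref 0` acting on `A` as `σ`, whose square
is `rot c`. The elements of `A` are the rotations `rot a`, the others are the reflections
`ref a = ref 0 * rot a`. -/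
inductive Twist.Extension {A : Type*} [AddCommGroup A] (T : Twist A)
  | rot : A → T.Extension
  | ref : A → T.Extension

namespace Twist

open Extension Multiplicative

variable {A : Type*} [AddCommGroup A] (T : Twist A)

instance : Mul T.Extension where
  mul
    | rot a, rot b => rot (a + b)
    | rot a, ref b => ref (T.σ a + b)
    | ref a, rot b => ref (a + b)
    | ref a, ref b => rot (T.c + T.σ a + b)

instance : One T.Extension := ⟨rot 0⟩

instance : Inv T.Extension where
  inv
    | rot a => rot (-a)
    | ref a => ref (-T.c - T.σ a)

theorem one_def : (1 : T.Extension) = rot 0 := rfl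

theorem rot_mul_rot (a b : A) : (rot a * rot b : T.Extension) = rot (a + b) := rfl

theorem rot_mul_ref (a b : A) : (rot a * ref b : T.Extension) = ref (T.σ a + b) := rfl

theorem ref_mul_rot (a b : A) : (ref a * rot b : T.Extension) = ref (a + b) := rfl

theorem ref_mul_ref (a b : A) : (ref a * ref b : T.Extension) = rot (T.c + T.σ a + b) := rfl

instance : Group T.Extension :=
  Group.ofLeftAxioms
    (by
      rintro (a | a) (b | b) (d | d) <;>
      simp only [rot_mul_rot, rot_mul_ref, ref_mul_rot, ref_mul_ref, map_add, T.σ_σ, T.σ_c,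
        rot.injEq, ref.injEq] <;>
      abel)
    (by
      rintro (a | a)
      · exact congrArg rot (zero_add a)
      · exact congrArg ref (by rw [map_zero, zero_add]))
    (by
      rintro (a | a)
      · exact congrArg rot (neg_add_cancel a)
      · refine congrArg rot ?_
        rw [map_sub, map_neg, T.σ_c, T.σ_σ]
        abel)

instance [Finite A] : Finite T.Extension :=
  Finite.of_surjective (Sum.elim rot ref : A ⊕ A → T.Extension) fun x => by
    cases x with
    | rot a => exact ⟨.inl a, rfl⟩
    | ref a => exact ⟨.inr a, rfl⟩

section Lift

theorem rot_pow (a : A) (i : ℕ) : (rot a : T.Extension) ^ i = rot (i • a) :=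
  (map_pow (MonoidHom.mk' (fun x : Multiplicative A => (rot x.toAdd : T.Extension))
    fun _ _ => rfl) (ofAdd a) i).symm

theorem rot_zpow (a : A) (i : ℤ) : (rot a : T.Extension) ^ i = rot (i • a) :=
  (map_zpow (MonoidHom.mk' (fun x : Multiplicative A => (rot x.toAdd : T.Extension))
    fun _ _ => rfl) (ofAdd a) i).symm

theorem ref_zero_sq : (ref 0 : T.Extension) ^ 2 = rot T.c := by
  rw [sq, ref_mul_ref, map_zero, add_zero, add_zero]

theorem ref_zero_mul_rot (a : A) : (ref 0 * rot a : T.Extension) = ref a := by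
  rw [ref_mul_rot, zero_add]

variable {T} {G : Type*} [Group G]

/-- The homomorphism from the extension to a group `G` that restricts to `φ` on `A` and maps
`ref 0` to `g`. -/
def lift (φ : Multiplicative A →* G) (g : G) (hg : g ^ 2 = φ (ofAdd T.c))
    (hφ : ∀ a, SemiconjBy g (φ (ofAdd (T.σ a))) (φ (ofAdd a))) : T.Extension →* G :=
  MonoidHom.mk'
    (fun
      | rot a => φ (ofAdd a)
      | ref a => g * φ (ofAdd a))
    (by
      rintro (a | a) (b | b)
      · exact map_mul φ (ofAdd a) (ofAdd b)
      · change g * φ (ofAdd (T.σ a) * ofAdd b) = φ (ofAdd a) * (g * φ (ofAdd b))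
        rw [map_mul, ← mul_assoc, ← mul_assoc, (hφ a).eq]
      · change g * φ (ofAdd a * ofAdd b) = g * φ (ofAdd a) * φ (ofAdd b)
        rw [map_mul, mul_assoc]
      · change φ (ofAdd T.c * ofAdd (T.σ a) * ofAdd b) = g * φ (ofAdd a) * (g * φ (ofAdd b))
        rw [map_mul, map_mul, ← hg, sq, mul_assoc g g, (hφ a).eq]
        simp only [mul_assoc])

theorem lift_ref_zero (φ : Multiplicative A →* G) (g : G) (hg : g ^ 2 = φ (ofAdd T.c))
    (hφ : ∀ a, SemiconjBy g (φ (ofAdd (T.σ a))) (φ (ofAdd a))) :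
    lift φ g hg hφ (ref 0) = g := by
  change g * φ (ofAdd 0) = g
  rw [ofAdd_zero, map_one, mul_one]

theorem hom_ext {f h : T.Extension →* G} (hrot : ∀ a, f (rot a) = h (rot a))
    (href : f (ref 0) = h (ref 0)) : f = h := by
  ext x
  cases x with
  | rot a => exact hrot a
  | ref a => rw [← ref_zero_mul_rot, map_mul, map_mul, href, hrot]

end Lift

end Twist

theorem isConj_iff_exists_mul_eq {G : Type*} [Group G] {x y : G} :
    IsConj x y ↔ ∃ g : G, g * x = y * g := by
  simp only [isConj_iff, mul_inv_eq_iff_eq_mul]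

theorem mem_of_isConj {G : Type*} [Group G] {N : Subgroup G} [hN : N.Normal] {x y : G}
    (h : IsConj x y) (hx : x ∈ N) : y ∈ N := by
  obtain ⟨g, rfl⟩ := isConj_iff.mp h
  exact hN.conj_mem x hx g

theorem card_eq_card_mul_of_fibers {X Y : Type*} [Finite X] [Finite Y] (g : X → Y) (k : ℕ)
    (h : ∀ y, Nat.card {x // g x = y} = k) : Nat.card X = Nat.card Y * k := by
  have := Fintype.ofFinite Y
  rw [Nat.card_congr (Equiv.sigmaFiberEquiv g).symm, Nat.card_sigma]
  simp [h]

theorem card_neg_add_mem {A : Type*} [AddGroup A] (H : AddSubgroup A) (a : A) :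
    Nat.card {x // -a + x ∈ H} = Nat.card H :=
  Nat.card_congr ((Equiv.addLeft (-a)).subtypeEquiv fun _ => Iff.rfl)

namespace Twist

open Extension

variable {A : Type*} [AddCommGroup A] (T : Twist A)

/-- The subgroup of the fixed points of `σ`. -/
def fixed : AddSubgroup A := (T.σ - AddMonoidHom.id A).ker

/-- The subgroup of the elements `σ a - a`. -/
def moved : AddSubgroup A := (T.σ - AddMonoidHom.id A).range

variable {T} in
theorem mem_fixed {a : A} : a ∈ T.fixed ↔ T.σ a = a := by
  simp [fixed, AddMonoidHom.mem_ker, sub_eq_zero]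

variable {T} in
theorem mem_moved {a : A} : a ∈ T.moved ↔ ∃ d, T.σ d - d = a := by
  simp [moved, AddMonoidHom.mem_range]

theorem card_fixed [Finite A] : Nat.card T.fixed = T.moved.index := by
  have h1 := T.moved.card_mul_index
  have h2 := T.fixed.card_mul_index
  have h3 : T.fixed.index = Nat.card T.moved := AddSubgroup.index_ker _
  rw [h3, mul_comm, ← h1] at h2
  exact Nat.eq_of_mul_eq_mul_left Nat.card_pos h2

section Conjugacy

variable {T} {a b : A}

theorem isConj_rot_rot : IsConj (rot a : T.Extension) (rot b) ↔ b = a ∨ b = T.σ a := by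
  rw [isConj_iff_exists_mul_eq]
  constructor
  · rintro ⟨d | d, hd⟩
    · rw [rot_mul_rot, rot_mul_rot, rot.injEq, add_comm] at hd
      exact Or.inl (add_right_cancel hd).symm
    · rw [ref_mul_rot, rot_mul_ref, ref.injEq, add_comm] at hd
      rw [add_right_cancel hd, T.σ_σ]
      exact Or.inr rfl
  · rintro (rfl | rfl)
    · exact ⟨1, by rw [one_mul, mul_one]⟩
    · exact ⟨ref 0, by rw [ref_mul_rot, rot_mul_ref, T.σ_σ, add_comm]⟩

theorem not_isConj_rot_ref : ¬ IsConj (rot a : T.Extension) (ref b) := by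
  rw [isConj_iff_exists_mul_eq]
  rintro ⟨d | d, hd⟩ <;> cases hd

theorem isConj_ref_ref : IsConj (ref a : T.Extension) (ref b) ↔ -a + b ∈ T.moved := by
  rw [isConj_iff_exists_mul_eq, mem_moved]
  constructor
  · rintro ⟨d | d, hd⟩
    · rw [rot_mul_ref, ref_mul_rot, ref.injEq] at hd
      refine ⟨d, ?_⟩
      rw [sub_eq_iff_eq_add, add_assoc, ← hd]
      abel
    · rw [ref_mul_ref, ref_mul_ref, rot.injEq] at hd
      refine ⟨a - d, ?_⟩
      have h := congrArg T.σ (show T.σ d + a = T.σ b + d by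
        simpa only [add_assoc, add_right_inj] using hd)
      simp only [map_add, T.σ_σ] at h
      rw [map_sub, show b = d + T.σ a - T.σ d by rw [h]; abel]
      abel
  · rintro ⟨d, hd⟩
    refine ⟨rot d, ?_⟩
    rw [rot_mul_ref, ref_mul_rot, ref.injEq, show b = a + (-a + b) by abel, ← hd]
    abel

theorem commute_rot_rot : Commute (rot a : T.Extension) (rot b) :=
  congrArg rot (add_comm a b)

theorem commute_rot_ref_iff : Commute (rot a : T.Extension) (ref b) ↔ T.σ a = a := by
  rw [commute_iff_eq, rot_mul_ref, ref_mul_rot, ref.injEq, add_comm, add_right_inj]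

theorem commute_ref_ref_iff : Commute (ref a : T.Extension) (ref b) ↔ -a + b ∈ T.fixed := by
  rw [commute_iff_eq, ref_mul_ref, ref_mul_ref, rot.injEq, add_assoc, add_assoc, add_right_inj,
    mem_fixed, map_add, map_neg, ← sub_eq_zero, ← neg_eq_zero,
    ← sub_eq_zero (a := -T.σ a + T.σ b)]
  exact iff_of_eq (by congr 1; abel)

theorem rot_mem_center_iff : (rot a : T.Extension) ∈ Subgroup.center T.Extension ↔ T.σ a = a := by
  rw [Subgroup.mem_center_iff]
  constructor
  · exact fun h => (commute_rot_ref_iff (b := 0)).mp (h _).symm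
  · rintro h (d | d)
    · exact commute_rot_rot
    · exact (commute_rot_ref_iff.mpr h).symm

theorem ref_notMem_center (hσ : ∃ a, T.σ a ≠ a) :
    (ref b : T.Extension) ∉ Subgroup.center T.Extension := by
  obtain ⟨d, hd⟩ := hσ
  exact fun h => hd (commute_rot_ref_iff.mp (Subgroup.mem_center_iff.mp h (rot d)))

/-- The clique of the commuting conjugacy class graph that contains the class of an element: all
rotations lie in one clique, the reflections `ref a` in cliques indexed by the class of `a`. -/
def cliqueOf : T.Extension → Option (A ⧸ (T.fixed ⊔ T.moved))
  | rot _ => none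
  | ref a => some a

theorem cliqueOf_eq_of_isConj {x y : T.Extension} (h : IsConj x y) : cliqueOf x = cliqueOf y := by
  rcases x with a | a <;> rcases y with b | b
  · rfl
  · exact (not_isConj_rot_ref h).elim
  · exact (not_isConj_rot_ref h.symm).elim
  · exact congrArg some (QuotientAddGroup.eq.mpr
      (AddSubgroup.mem_sup_right (isConj_ref_ref.mp h)))

theorem cliqueOf_eq_of_commute {x y : T.Extension} (hx : x ∉ Subgroup.center T.Extension)
    (hy : y ∉ Subgroup.center T.Extension) (h : Commute x y) : cliqueOf x = cliqueOf y := by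
  rcases x with a | a <;> rcases y with b | b
  · rfl
  · exact (hx (rot_mem_center_iff.mpr (commute_rot_ref_iff.mp h))).elim
  · exact (hy (rot_mem_center_iff.mpr (commute_rot_ref_iff.mp h.symm))).elim
  · exact congrArg some (QuotientAddGroup.eq.mpr
      (AddSubgroup.mem_sup_left (commute_ref_ref_iff.mp h)))

theorem exists_isConj_commute_of_cliqueOf_eq {x y : T.Extension} (h : cliqueOf x = cliqueOf y) :
    ∃ z, IsConj z y ∧ Commute x z := by
  rcases x with a | a <;> rcases y with b | b
  · exact ⟨_, IsConj.refl _, commute_rot_rot⟩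
  · cases h
  · cases h
  · obtain ⟨z, hz, w, hw, hzw⟩ :=
      AddSubgroup.mem_sup.mp (QuotientAddGroup.eq.mp (Option.some_injective _ h))
    refine ⟨ref (a + z), isConj_ref_ref.mpr ?_, commute_ref_ref_iff.mpr ?_⟩
    · rwa [neg_add_rev, add_assoc, ← hzw, neg_add_cancel_left]
    · rwa [neg_add_cancel_left]

end Conjugacy

/-- The clique of a vertex of the commuting conjugacy class graph. -/
def component (v : Vertex T.Extension) : Option (A ⧸ (T.fixed ⊔ T.moved)) :=
  Quotient.lift cliqueOf (fun _ _ => cliqueOf_eq_of_isConj) v.1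

theorem cccGraph_eq_clusterGraph : cccGraph T.Extension = clusterGraph T.component := by
  ext ⟨_, x, hx, rfl⟩ ⟨_, y, hy, rfl⟩
  refine and_congr_right fun _ => ⟨?_, fun h => ?_⟩
  · rintro ⟨x', y', hx', hy', h⟩
    replace hx' := ConjClasses.mk_eq_mk_iff_isConj.mp hx'
    replace hy' := ConjClasses.mk_eq_mk_iff_isConj.mp hy'
    calc cliqueOf x = cliqueOf x' := (cliqueOf_eq_of_isConj hx').symm
      _ = cliqueOf y' :=
        cliqueOf_eq_of_commute (mt (mem_of_isConj hx') hx) (mt (mem_of_isConj hy') hy) h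
      _ = cliqueOf y := cliqueOf_eq_of_isConj hy'
  · obtain ⟨z, hz, hxz⟩ := exists_isConj_commute_of_cliqueOf_eq h
    exact ⟨x, z, rfl, ConjClasses.mk_eq_mk_iff_isConj.mpr hz, hxz⟩

section Counting

/-- The conjugacy class of a non-central rotation. -/
def rotVertex (a : {a // T.σ a ≠ a}) : Vertex T.Extension :=
  ⟨ConjClasses.mk (rot a), rot a, mt rot_mem_center_iff.mp a.2, rfl⟩

/-- The conjugacy class of a reflection. -/
def refVertex (hσ : ∃ a, T.σ a ≠ a) (a : A) : Vertex T.Extension :=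
  ⟨ConjClasses.mk (ref a), ref a, ref_notMem_center hσ, rfl⟩

variable {T}

theorem exists_rotVertex_eq {v : Vertex T.Extension} (hv : T.component v = none) :
    ∃ a, T.rotVertex a = v := by
  obtain ⟨_, a | a, ha, rfl⟩ := v
  · exact ⟨⟨a, mt rot_mem_center_iff.mpr ha⟩, rfl⟩
  · cases hv

theorem exists_refVertex_eq (hσ : ∃ a, T.σ a ≠ a) {v : Vertex T.Extension} {a : A}
    (hv : T.component v = some a) : ∃ b, -a + b ∈ T.fixed ⊔ T.moved ∧ T.refVertex hσ b = v := by
  obtain ⟨_, b | b, hb, rfl⟩ := v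
  · cases hv
  · exact ⟨b, QuotientAddGroup.eq.mp (Option.some_injective _ hv).symm, rfl⟩

theorem rotVertex_eq_iff {a b : {a // T.σ a ≠ a}} :
    T.rotVertex a = T.rotVertex b ↔ (b : A) = a ∨ (b : A) = T.σ a := by
  rw [rotVertex, rotVertex, Subtype.mk.injEq, ConjClasses.mk_eq_mk_iff_isConj, isConj_rot_rot]

theorem refVertex_eq_iff {hσ : ∃ a, T.σ a ≠ a} {a b : A} :
    T.refVertex hσ a = T.refVertex hσ b ↔ -a + b ∈ T.moved := by
  rw [refVertex, refVertex, Subtype.mk.injEq, ConjClasses.mk_eq_mk_iff_isConj, isConj_ref_ref]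

theorem card_rotVertex_fiber (a : {a // T.σ a ≠ a}) :
    Nat.card {b // T.rotVertex b = T.rotVertex a} = 2 := by
  have hσa : T.σ (T.σ a) ≠ T.σ a := by rw [T.σ_σ]; exact a.2.symm
  rw [Nat.card_eq_two_iff]
  refine ⟨⟨a, rfl⟩, ⟨⟨T.σ a, hσa⟩, rotVertex_eq_iff.mpr (Or.inr (T.σ_σ _).symm)⟩, ?_, ?_⟩
  · exact fun h => a.2 (congrArg (fun x => (x.1.1 : A)) h).symm
  · rw [Set.eq_univ_iff_forall]
    rintro ⟨b, hb⟩
    simpa [Subtype.ext_iff] using rotVertex_eq_iff.mp hb.symm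

variable (T) in
theorem two_mul_cliqueSize_none [Finite A] :
    2 * cliqueSize T.component none + T.moved.index = Nat.card A := by
  have hmoving : Nat.card {a // T.σ a ≠ a} = cliqueSize T.component none * 2 := by
    refine card_eq_card_mul_of_fibers
      (fun a => (⟨T.rotVertex a, rfl⟩ : {v // T.component v = none})) 2 ?_
    rintro ⟨v, hv⟩
    obtain ⟨a, rfl⟩ := exists_rotVertex_eq hv
    exact (Nat.card_congr (Equiv.subtypeEquivRight fun _ => Subtype.ext_iff)).trans
      (card_rotVertex_fiber a)
  have hfixed : Nat.card {a // T.σ a = a} = T.moved.index := by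
    rw [← card_fixed]
    exact Nat.card_congr (Equiv.subtypeEquivRight fun a => mem_fixed.symm)
  have htotal : Nat.card A = Nat.card {a // T.σ a = a} + Nat.card {a // T.σ a ≠ a} := by
    classical
    rw [← Nat.card_sum]
    exact Nat.card_congr (Equiv.sumCompl fun a => T.σ a = a).symm
  omega

theorem card_refVertex_fiber (hσ : ∃ a, T.σ a ≠ a) (a : A) :
    Nat.card {b // T.refVertex hσ b = T.refVertex hσ a} = Nat.card T.moved := by
  rw [← card_neg_add_mem _ a]
  exact Nat.card_congr (Equiv.subtypeEquivRight fun b => eq_comm.trans refVertex_eq_iff)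

theorem index_mul_cliqueSize_some [Finite A] (hσ : ∃ a, T.σ a ≠ a)
    (q : A ⧸ (T.fixed ⊔ T.moved)) :
    (T.fixed ⊔ T.moved).index * cliqueSize T.component (some q) = T.moved.index := by
  obtain ⟨a, rfl⟩ := QuotientAddGroup.mk_surjective q
  have hcoset : Nat.card {x // -a + x ∈ T.fixed ⊔ T.moved} =
      cliqueSize T.component (some (QuotientAddGroup.mk a)) * Nat.card T.moved := by
    refine card_eq_card_mul_of_fibers
      (fun x : {x // -a + x ∈ T.fixed ⊔ T.moved} =>
        (⟨T.refVertex hσ x, congrArg some (QuotientAddGroup.eq.mpr x.2).symm⟩ :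
          {v // T.component v = some (QuotientAddGroup.mk a)})) _ ?_
    rintro ⟨v, hv⟩
    obtain ⟨b, hb, rfl⟩ := exists_refVertex_eq hσ hv
    rw [← card_refVertex_fiber hσ b]
    refine Nat.card_congr ((Equiv.subtypeEquivRight fun _ => Subtype.ext_iff).trans
      (Equiv.subtypeSubtypeEquivSubtype (q := fun x => T.refVertex hσ x = T.refVertex hσ b) ?_))
    intro x hx
    have h := add_mem hb (AddSubgroup.mem_sup_right (refVertex_eq_iff.mp hx.symm))
    rwa [add_assoc, add_neg_cancel_left] at h
  refine Nat.eq_of_mul_eq_mul_right (m := Nat.card T.moved) Nat.card_pos ?_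
  rw [mul_assoc, ← hcoset, card_neg_add_mem, AddSubgroup.index_mul_card, AddSubgroup.index_mul_card]

end Counting

theorem isCliqueUnion [Finite A] {k a b : ℕ} (ha₀ : 0 < a)
    (hk : (T.fixed ⊔ T.moved).index = k) (ha : 2 * a + T.moved.index = Nat.card A)
    (hb : k * b = T.moved.index) : IsCliqueUnion (cccGraph T.Extension) k a b := by
  have hk₀ : 0 < k := hk ▸ Nat.pos_of_ne_zero AddSubgroup.index_ne_zero_of_finite
  have hσ : ∃ a, T.σ a ≠ a := by
    by_contra! h
    have hfixed := T.card_fixed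
    rw [(AddSubgroup.eq_top_iff' _).mpr fun a => mem_fixed.mpr (h a),
      AddSubgroup.card_top] at hfixed
    omega
  have hnone : cliqueSize T.component none = a := by
    have := T.two_mul_cliqueSize_none
    omega
  have hsome (q) : cliqueSize T.component (some q) = b :=
    Nat.eq_of_mul_eq_mul_left hk₀ (by rw [hb, ← T.index_mul_cliqueSize_some hσ q, hk])
  rw [cccGraph_eq_clusterGraph, ← hk, ← hnone]
  exact isCliqueUnion_clusterGraph T.component hsome

theorem isEmpty_vertex (hσ : ∀ a, T.σ a = a) : IsEmpty (Vertex T.Extension) := by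
  refine ⟨fun ⟨_, x, hx, _⟩ => hx (Subgroup.mem_center_iff.mpr fun y => ?_)⟩
  rcases x with a | a <;> rcases y with b | b
  · exact commute_rot_rot
  · exact (commute_rot_ref_iff.mpr (hσ a)).symm
  · exact commute_rot_ref_iff.mpr (hσ b)
  · exact commute_ref_ref_iff.mpr (mem_fixed.mpr (hσ _))

end Twist

section MulEquiv

variable {G H : Type*} [Group G] [Group H]

/-- The bijection of conjugacy classes induced by an isomorphism of groups. -/
def conjClassesCongr (e : G ≃* H) : ConjClasses G ≃ ConjClasses H where
  toFun := ConjClasses.map e.toMonoidHom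
  invFun := ConjClasses.map e.symm.toMonoidHom
  left_inv := by rintro ⟨x⟩; exact congrArg ConjClasses.mk (e.symm_apply_apply x)
  right_inv := by rintro ⟨x⟩; exact congrArg ConjClasses.mk (e.apply_symm_apply x)

theorem map_mem_center_iff (e : G ≃* H) {x : G} :
    e x ∈ Subgroup.center H ↔ x ∈ Subgroup.center G := by
  simp only [Subgroup.mem_center_iff, e.surjective.forall, ← map_mul, e.injective.eq_iff]

/-- The bijection of the vertices of the commuting conjugacy class graphs induced by an isomorphism
of groups. -/
def vertexCongr (e : G ≃* H) : Vertex G ≃ Vertex H :=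
  (conjClassesCongr e).subtypeEquiv <| by
    rintro ⟨x⟩
    constructor
    · rintro ⟨y, hy, hyx⟩
      exact ⟨e y, mt (map_mem_center_iff e).mp hy, congrArg (ConjClasses.map e.toMonoidHom) hyx⟩
    · rintro ⟨y, hy, hyx⟩
      refine ⟨e.symm y, mt (map_mem_center_iff e.symm).mp hy, ?_⟩
      exact (congrArg (conjClassesCongr e).symm hyx).trans ((conjClassesCongr e).symm_apply_apply _)

theorem adj_vertexCongr_of_adj (e : G ≃* H) {u v : Vertex G} (h : (cccGraph G).Adj u v) :
    (cccGraph H).Adj (vertexCongr e u) (vertexCongr e v) := by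
  obtain ⟨huv, x, y, hx, hy, hxy⟩ := h
  exact ⟨(vertexCongr e).injective.ne huv, e x, e y,
    congrArg (conjClassesCongr e) hx, congrArg (conjClassesCongr e) hy, by
      rw [← map_mul, hxy, map_mul]⟩

/-- The isomorphism of the commuting conjugacy class graphs induced by an isomorphism of groups. -/
def cccGraphCongr (e : G ≃* H) : cccGraph G ≃g cccGraph H where
  toEquiv := vertexCongr e
  map_rel_iff' {u v} :=
    ⟨fun h => by
      have hu : vertexCongr e.symm (vertexCongr e u) = u := (vertexCongr e).symm_apply_apply u
      have hv : vertexCongr e.symm (vertexCongr e v) = v := (vertexCongr e).symm_apply_apply v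
      have h' := adj_vertexCongr_of_adj e.symm h
      rwa [hu, hv] at h',
      adj_vertexCongr_of_adj e⟩

end MulEquiv

/-! ### The dihedral, dicyclic, semidihedral and metacyclic groups as extensions -/

open Multiplicative

/-- The involution `a ↦ r * a` of a commutative ring with `r ^ 2 = 1`, and a fixed point of it. -/
def Twist.mulLeft {R : Type*} [CommRing R] (r c : R) (hr : r * r = 1) (hc : r * c = c) :
    Twist R where
  σ := AddMonoidHom.mulLeft r
  c := c
  σ_σ a := by rw [AddMonoidHom.coe_mulLeft, ← mul_assoc, hr, one_mul]
  σ_c := hc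

/-- The twist whose extension is the dihedral group of order `2n`. -/
def twistD (n : ℕ) : Twist (ZMod n) := .mulLeft (-1) 0 (by ring) (by ring)

/-- The twist whose extension is the quaternion group of order `4n`. -/
def twistQ (n : ℕ) : Twist (ZMod (2 * n)) :=
  .mulLeft (-1) n (by ring) <| by
    have h : (2 * n : ZMod (2 * n)) = 0 := by exact_mod_cast ZMod.natCast_self (2 * n)
    linear_combination -h

/-- The twist whose extension is the semidihedral group of order `8n`. -/
def twistSD (n : ℕ) : Twist (ZMod (4 * n)) :=
  .mulLeft (2 * n - 1) 0 (by
    have h : (4 * n : ZMod (4 * n)) = 0 := by exact_mod_cast ZMod.natCast_self (4 * n)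
    linear_combination (n - 1 : ZMod (4 * n)) * h) (mul_zero _)

/-- The twist whose extension is the group `U_{(n,m)}`. -/
def twistU (n m : ℕ) : Twist (ZMod n × ZMod m) := .mulLeft (1, -1) (1, 0) (by simp) (by simp)

/-- The homomorphism from `ℤ/N` to a group that maps `1` to a given element `x` with
`x ^ N = 1`. -/
def zmodPowHom {G : Type*} [Group G] {N : ℕ} (x : G) (hx : x ^ N = 1) :
    Multiplicative (ZMod N) →* G :=
  AddMonoidHom.toMultiplicativeLeft <| ZMod.lift N ⟨zmultiplesHom (Additive G) (.ofMul x), by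
    rw [zmultiplesHom_apply, natCast_zsmul, ← ofMul_pow, hx, ofMul_one]⟩

theorem zmodPowHom_intCast {G : Type*} [Group G] {N : ℕ} (x : G) (hx : x ^ N = 1) (i : ℤ) :
    zmodPowHom x hx (ofAdd (i : ZMod N)) = x ^ i :=
  congrArg Additive.toMul (ZMod.lift_coe N _ i)

/-- The homomorphism `(i, j) ↦ x ^ i * y ^ j` from `ℤ/n × ℤ/m` to a group, where `x` and `y` are
commuting elements with `x ^ n = 1` and `y ^ m = 1`. -/
def zmodProdPowHom {G : Type*} [Group G] {n m : ℕ} (x y : G) (hx : x ^ n = 1) (hy : y ^ m = 1)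
    (hxy : Commute x y) : Multiplicative (ZMod n × ZMod m) →* G :=
  (MonoidHom.noncommCoprod (zmodPowHom x hx) (zmodPowHom y hy) fun i j => by
    obtain ⟨i, rfl⟩ := ZMod.intCast_surjective i.toAdd
    obtain ⟨j, rfl⟩ := ZMod.intCast_surjective j.toAdd
    exact (zmodPowHom_intCast x hx i).symm ▸ (zmodPowHom_intCast y hy j).symm ▸
      hxy.zpow_zpow i j).comp
    (MulEquiv.prodMultiplicative (ZMod n) (ZMod m)).toMonoidHom

theorem zmodProdPowHom_intCast {G : Type*} [Group G] {n m : ℕ} (x y : G) (hx : x ^ n = 1)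
    (hy : y ^ m = 1) (hxy : Commute x y) (i j : ℤ) :
    zmodProdPowHom x y hx hy hxy (ofAdd ((i : ZMod n), (j : ZMod m))) = x ^ i * y ^ j :=
  congrArg₂ (· * ·) (zmodPowHom_intCast x hx i) (zmodPowHom_intCast y hy j)

/-- The dihedral group of order `2n` as an extension of `ℤ/n`. -/
def dihedralMulEquiv (n : ℕ) : DihedralGroup n ≃* (twistD n).Extension where
  toFun
    | .r i => .rot i
    | .sr i => .ref i
  invFun
    | .rot i => .r i
    | .ref i => .sr i
  left_inv := by rintro (i | i) <;> rfl
  right_inv := by rintro (i | i) <;> rfl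
  map_mul' := by
    rintro (i | i) (j | j)
    · rfl
    · exact congrArg Twist.Extension.ref (show j - i = -1 * i + j by ring)
    · rfl
    · exact congrArg Twist.Extension.rot (show j - i = 0 + -1 * i + j by ring)

/-- The dicyclic group `T_{4n}`, which is `QuaternionGroup n`, as an extension of `ℤ/2n`. -/
def quaternionMulEquiv (n : ℕ) : QuaternionGroup n ≃* (twistQ n).Extension where
  toFun
    | .a i => .rot i
    | .xa i => .ref i
  invFun
    | .rot i => .a i
    | .ref i => .xa i
  left_inv := by rintro (i | i) <;> rfl
  right_inv := by rintro (i | i) <;> rfl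
  map_mul' := by
    rintro (i | i) (j | j)
    · rfl
    · exact congrArg Twist.Extension.ref (show j - i = -1 * i + j by ring)
    · rfl
    · exact congrArg Twist.Extension.rot (show n + j - i = n + -1 * i + j by ring)

section GroupU

variable (n m : ℕ)

theorem groupU_genX_pow : (PresentedGroup.of 0 : GroupU n m) ^ (2 * n) = 1 :=
  PresentedGroup.one_of_mem (x := genX ^ (2 * n)) (by simp)

theorem groupU_genY_pow : (PresentedGroup.of 1 : GroupU n m) ^ m = 1 :=
  PresentedGroup.one_of_mem (x := genY ^ m) (by simp)

theorem groupU_semiconjBy : SemiconjBy (PresentedGroup.of 0 : GroupU n m)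
    (PresentedGroup.of 1)⁻¹ (PresentedGroup.of 1) := by
  have h : (PresentedGroup.of 0 : GroupU n m)⁻¹ * PresentedGroup.of 1 * PresentedGroup.of 0 =
      (PresentedGroup.of 1)⁻¹ :=
    PresentedGroup.mk_eq_mk_of_mul_inv_mem (x := genX⁻¹ * genY * genX) (y := genY⁻¹) (by simp)
  exact (inv_mul_eq_iff_eq_mul.mp ((mul_assoc _ _ _).symm.trans h)).symm

/-- The homomorphism from `U_{(n,m)}` to its model as an extension. -/
def groupUToExtension : GroupU n m →* (twistU n m).Extension :=
  PresentedGroup.toGroup (f := ![.ref 0, .rot (0, 1)]) <| by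
    rintro r (rfl | rfl | rfl)
    · simp only [map_pow, genX, FreeGroup.lift_apply_of, Matrix.cons_val_zero, pow_mul,
        Twist.ref_zero_sq, Twist.rot_pow, Twist.one_def]
      simp [twistU, Twist.mulLeft]
    · simp only [map_pow, genY, FreeGroup.lift_apply_of, Matrix.cons_val_one,
        Matrix.cons_val_zero, Twist.rot_pow, Twist.one_def]
      simp
    · simp only [map_mul, map_inv, inv_inv, genX, genY, FreeGroup.lift_apply_of,
        Matrix.cons_val_one, Matrix.cons_val_zero]
      rw [mul_assoc, mul_assoc, inv_mul_eq_one, ← mul_assoc]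
      simp only [Twist.rot_mul_ref, Twist.ref_mul_rot]
      simp [twistU, Twist.mulLeft, ← Prod.zero_eq_mk]

theorem groupU_commute :
    Commute ((PresentedGroup.of 0 : GroupU n m) ^ 2) (PresentedGroup.of 1) := by
  have h := groupU_semiconjBy n m
  rw [sq]
  exact h.mul_left (by simpa only [inv_inv] using h.inv_right)

/-- The inverse of `groupUToExtension`: the pair `(i, j)` is mapped to `x ^ (2i) * y ^ j`. -/
def groupUOfExtension : (twistU n m).Extension →* GroupU n m :=
  Twist.lift
    (zmodProdPowHom (PresentedGroup.of 0 ^ 2) (PresentedGroup.of 1)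
      (by rw [← pow_mul, groupU_genX_pow]) (groupU_genY_pow n m) (groupU_commute n m))
    (PresentedGroup.of 0)
    (by
      have h := zmodProdPowHom_intCast (PresentedGroup.of 0 ^ 2) (PresentedGroup.of 1)
        (by rw [← pow_mul, groupU_genX_pow]) (groupU_genY_pow n m) (groupU_commute n m) 1 0
      simpa [twistU, Twist.mulLeft] using h.symm)
    (by
      rintro ⟨i, j⟩
      obtain ⟨i, rfl⟩ := ZMod.intCast_surjective i
      obtain ⟨j, rfl⟩ := ZMod.intCast_surjective j
      have hσ : (twistU n m).σ ((i : ZMod n), (j : ZMod m)) =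
          ((i : ZMod n), ((-j : ℤ) : ZMod m)) := by
        simp [twistU, Twist.mulLeft]
      rw [hσ, zmodProdPowHom_intCast, zmodProdPowHom_intCast, zpow_neg, ← inv_zpow]
      exact SemiconjBy.mul_right (((Commute.refl _).pow_right 2).zpow_right i)
        ((groupU_semiconjBy n m).zpow_right j))

theorem groupUToExtension_of_zero : groupUToExtension n m (.of 0) = .ref 0 :=
  PresentedGroup.toGroup.of _

theorem groupUToExtension_of_one : groupUToExtension n m (.of 1) = .rot (0, 1) :=
  PresentedGroup.toGroup.of _

theorem groupUOfExtension_ref_zero : groupUOfExtension n m (.ref 0) = .of 0 :=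
  Twist.lift_ref_zero _ _ _ _

theorem groupUOfExtension_rot (i j : ℤ) :
    groupUOfExtension n m (.rot (i, j)) = (.of 0 ^ 2) ^ i * .of 1 ^ j :=
  zmodProdPowHom_intCast _ _ _ (groupU_genY_pow n m) (groupU_commute n m) i j

/-- The group `U_{(n,m)}` is an extension of `ℤ/n × ℤ/m`, with `x = ref 0` and
`y = rot (0, 1)`. -/
def groupUMulEquiv : GroupU n m ≃* (twistU n m).Extension :=
  (groupUToExtension n m).toMulEquiv (groupUOfExtension n m)
    (PresentedGroup.ext <| Fin.forall_fin_two.mpr ⟨by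
      rw [MonoidHom.comp_apply, groupUToExtension_of_zero, groupUOfExtension_ref_zero,
        MonoidHom.id_apply], by
      have h := groupUOfExtension_rot n m 0 1
      rw [MonoidHom.comp_apply, groupUToExtension_of_one, MonoidHom.id_apply]
      simpa using h⟩)
    (Twist.hom_ext (by
      rintro ⟨i, j⟩
      obtain ⟨i, rfl⟩ := ZMod.intCast_surjective i
      obtain ⟨j, rfl⟩ := ZMod.intCast_surjective j
      rw [MonoidHom.comp_apply, groupUOfExtension_rot, map_mul, map_zpow, map_zpow, map_pow,
        groupUToExtension_of_zero, groupUToExtension_of_one, Twist.ref_zero_sq, Twist.rot_zpow,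
        Twist.rot_zpow, Twist.rot_mul_rot, MonoidHom.id_apply]
      simp [twistU, Twist.mulLeft]) (by
      rw [MonoidHom.comp_apply, groupUOfExtension_ref_zero, groupUToExtension_of_zero,
        MonoidHom.id_apply]))

end GroupU

section GroupSD

variable (n : ℕ)

theorem groupSD_genX_pow : (PresentedGroup.of 0 : GroupSD n) ^ (4 * n) = 1 :=
  PresentedGroup.one_of_mem (x := genX ^ (4 * n)) (by simp)

theorem groupSD_genY_sq : (PresentedGroup.of 1 : GroupSD n) ^ 2 = 1 :=
  PresentedGroup.one_of_mem (x := genY ^ 2) (by simp)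

theorem groupSD_semiconjBy : SemiconjBy (PresentedGroup.of 1 : GroupSD n)
    (PresentedGroup.of 0 ^ (2 * n - 1)) (PresentedGroup.of 0) := by
  have h : (PresentedGroup.of 1 : GroupSD n) * PresentedGroup.of 0 * PresentedGroup.of 1 =
      PresentedGroup.of 0 ^ (2 * n - 1) :=
    PresentedGroup.mk_eq_mk_of_mul_inv_mem (x := genY * genX * genY) (y := genX ^ (2 * n - 1))
      (by simp)
  have hy : (PresentedGroup.of 1 : GroupSD n)⁻¹ = PresentedGroup.of 1 :=
    inv_eq_of_mul_eq_one_right (by rw [← sq, groupSD_genY_sq])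
  rw [SemiconjBy, ← h, ← eq_inv_mul_iff_mul_eq, hy]
  exact mul_assoc _ _ _

/-- The homomorphism from `SD_{8n}` to its model as an extension. -/
def groupSDToExtension [NeZero n] : GroupSD n →* (twistSD n).Extension :=
  PresentedGroup.toGroup (f := ![.rot 1, .ref 0]) <| by
    have hn := NeZero.pos n
    rintro r (rfl | rfl | rfl)
    · simp only [map_pow, genX, FreeGroup.lift_apply_of, Matrix.cons_val_zero, Twist.rot_pow,
        Twist.one_def, nsmul_eq_mul, ZMod.natCast_self, zero_mul]
    · simp only [map_pow, genY, FreeGroup.lift_apply_of, Matrix.cons_val_one,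
        Matrix.cons_val_zero, Twist.ref_zero_sq, Twist.one_def]
      simp [twistSD, Twist.mulLeft]
    · rw [map_mul, map_inv, mul_inv_eq_one]
      simp only [map_mul, map_pow, genX, genY, FreeGroup.lift_apply_of, Matrix.cons_val_one,
        Matrix.cons_val_zero, Twist.ref_mul_rot, Twist.ref_mul_ref, Twist.rot_pow]
      have : ((2 * n - 1 : ℕ) : ZMod (4 * n)) = 2 * n - 1 := by
        rw [Nat.cast_sub (by omega)]
        push_cast
        rfl
      simp [twistSD, Twist.mulLeft, this]

/-- The inverse of `groupSDToExtension`. -/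
def groupSDOfExtension [NeZero n] : (twistSD n).Extension →* GroupSD n :=
  Twist.lift (zmodPowHom (PresentedGroup.of 0) (groupSD_genX_pow n)) (PresentedGroup.of 1)
    (by rw [groupSD_genY_sq]; exact (map_one _).symm)
    (by
      intro i
      obtain ⟨i, rfl⟩ := ZMod.intCast_surjective i
      have hn := NeZero.pos n
      have hσ : (twistSD n).σ (i : ZMod (4 * n)) = (((2 * n - 1 : ℕ) * i : ℤ) : ZMod (4 * n)) := by
        rw [Nat.cast_sub (by omega)]
        simp [twistSD, Twist.mulLeft]
      rw [hσ, zmodPowHom_intCast, zmodPowHom_intCast, zpow_mul, zpow_natCast]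
      exact (groupSD_semiconjBy n).zpow_right i)

theorem groupSDToExtension_of_zero [NeZero n] : groupSDToExtension n (.of 0) = .rot 1 :=
  PresentedGroup.toGroup.of _

theorem groupSDToExtension_of_one [NeZero n] : groupSDToExtension n (.of 1) = .ref 0 :=
  PresentedGroup.toGroup.of _

theorem groupSDOfExtension_rot [NeZero n] (i : ℤ) :
    groupSDOfExtension n (.rot i) = .of 0 ^ i :=
  zmodPowHom_intCast _ (groupSD_genX_pow n) i

theorem groupSDOfExtension_ref_zero [NeZero n] : groupSDOfExtension n (.ref 0) = .of 1 :=
  Twist.lift_ref_zero _ _ _ _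

/-- The group `SD_{8n}` is an extension of `ℤ/4n`, with `x = rot 1` and `y = ref 0`. -/
def groupSDMulEquiv [NeZero n] : GroupSD n ≃* (twistSD n).Extension :=
  (groupSDToExtension n).toMulEquiv (groupSDOfExtension n)
    (PresentedGroup.ext <| Fin.forall_fin_two.mpr ⟨by
      have h := groupSDOfExtension_rot n 1
      rw [MonoidHom.comp_apply, groupSDToExtension_of_zero, MonoidHom.id_apply]
      simpa using h, by
      rw [MonoidHom.comp_apply, groupSDToExtension_of_one, groupSDOfExtension_ref_zero,
        MonoidHom.id_apply]⟩)
    (Twist.hom_ext (by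
      intro i
      obtain ⟨i, rfl⟩ := ZMod.intCast_surjective i
      rw [MonoidHom.comp_apply, groupSDOfExtension_rot, map_zpow, groupSDToExtension_of_zero,
        Twist.rot_zpow, zsmul_one, MonoidHom.id_apply]) (by
      rw [MonoidHom.comp_apply, groupSDOfExtension_ref_zero, groupSDToExtension_of_one,
        MonoidHom.id_apply]))

end GroupSD

/-! ### The graphs and their energies -/

theorem index_eq_of_intCast_mem_iff {N d : ℕ} (hd : d ∣ N) {H : AddSubgroup (ZMod N)}
    (h : ∀ x : ℤ, (x : ZMod N) ∈ H ↔ (d : ℤ) ∣ x) : H.index = d := by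
  have hH : H = (ZMod.castHom hd (ZMod d)).toAddMonoidHom.ker := by
    ext y
    obtain ⟨x, rfl⟩ := ZMod.intCast_surjective y
    rw [h, AddMonoidHom.mem_ker, ← ZMod.intCast_zmod_eq_zero_iff_dvd]
    simp
  rw [hH, AddSubgroup.index_ker, AddMonoidHom.range_eq_top.mpr (ZMod.castHom_surjective hd),
    AddSubgroup.card_top, Nat.card_zmod]

section MulLeft

variable {g d : ℕ} {t : ℤ}

theorem intCast_mem_range_mulLeft (h : IsCoprime (d : ℤ) t) {x : ℤ} :
    (x : ZMod (g * d)) ∈ (AddMonoidHom.mulLeft ((g * t : ℤ) : ZMod (g * d))).range ↔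
      (g : ℤ) ∣ x := by
  constructor
  · rintro ⟨y, hy⟩
    obtain ⟨y, rfl⟩ := ZMod.intCast_surjective y
    rw [AddMonoidHom.coe_mulLeft, ← Int.cast_mul, ZMod.intCast_eq_intCast_iff_dvd_sub,
      Nat.cast_mul] at hy
    exact (dvd_sub_left ⟨t * y, by ring⟩).mp (dvd_of_mul_right_dvd hy)
  · rintro ⟨x, rfl⟩
    obtain ⟨u, v, huv⟩ := h
    refine ⟨(v * x : ℤ), ?_⟩
    rw [AddMonoidHom.coe_mulLeft, ← Int.cast_mul, ZMod.intCast_eq_intCast_iff_dvd_sub,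
      Nat.cast_mul]
    exact ⟨u * x, by linear_combination -(g * x : ℤ) * huv⟩

theorem intCast_mem_ker_mulLeft (hg : g ≠ 0) (h : IsCoprime (d : ℤ) t) {x : ℤ} :
    (x : ZMod (g * d)) ∈ (AddMonoidHom.mulLeft ((g * t : ℤ) : ZMod (g * d))).ker ↔
      (d : ℤ) ∣ x := by
  rw [AddMonoidHom.mem_ker, AddMonoidHom.coe_mulLeft, ← Int.cast_mul,
    ZMod.intCast_zmod_eq_zero_iff_dvd, Nat.cast_mul, mul_assoc,
    mul_dvd_mul_iff_left (Nat.cast_ne_zero.mpr hg)]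
  exact ⟨h.dvd_of_dvd_mul_left, fun hx => hx.mul_left t⟩

theorem index_range_mulLeft (h : IsCoprime (d : ℤ) t) :
    (AddMonoidHom.mulLeft ((g * t : ℤ) : ZMod (g * d))).range.index = g :=
  index_eq_of_intCast_mem_iff (dvd_mul_right g d) fun _ => intCast_mem_range_mulLeft h

theorem index_ker_sup_range_mulLeft (hg : g ≠ 0) (h : IsCoprime (d : ℤ) t) :
    ((AddMonoidHom.mulLeft ((g * t : ℤ) : ZMod (g * d))).ker ⊔
      (AddMonoidHom.mulLeft ((g * t : ℤ) : ZMod (g * d))).range).index = g.gcd d := by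
  refine index_eq_of_intCast_mem_iff ((g.gcd_dvd_left d).mul_right d) fun x => ?_
  rw [← Int.gcd_natCast_natCast, Int.coe_gcd, gcd_dvd_iff_exists, AddSubgroup.mem_sup]
  constructor
  · rintro ⟨u, hu, v, hv, huv⟩
    obtain ⟨u, rfl⟩ := ZMod.intCast_surjective u
    obtain ⟨v, rfl⟩ := ZMod.intCast_surjective v
    obtain ⟨u, rfl⟩ := (intCast_mem_ker_mulLeft hg h).mp hu
    obtain ⟨v, rfl⟩ := (intCast_mem_range_mulLeft h).mp hv
    rw [← Int.cast_add, ZMod.intCast_eq_intCast_iff_dvd_sub, Nat.cast_mul] at huv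
    obtain ⟨w, hw⟩ := huv
    exact ⟨v + d * w, u, by linear_combination hw⟩
  · rintro ⟨v, u, rfl⟩
    exact ⟨(d * u : ℤ), (intCast_mem_ker_mulLeft hg h).mpr (dvd_mul_right _ _),
      (g * v : ℤ), (intCast_mem_range_mulLeft h).mpr (dvd_mul_right _ _), by push_cast; ring⟩

end MulLeft

theorem ker_sup_range_prodMap_zero {A B : Type*} [AddCommGroup A] [AddCommGroup B] (f : B →+ B) :
    (AddMonoidHom.prodMap (0 : A →+ A) f).ker ⊔ (AddMonoidHom.prodMap (0 : A →+ A) f).range =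
      (⊤ : AddSubgroup A).prod (f.ker ⊔ f.range) := by
  rw [AddMonoidHom.ker_prodMap, AddMonoidHom.range_prodMap, AddMonoidHom.ker_zero]
  apply le_antisymm
  · exact sup_le (AddSubgroup.prod_mono le_rfl le_sup_left)
      (AddSubgroup.prod_mono le_top le_sup_right)
  · rintro ⟨x, y⟩ ⟨-, hy⟩
    obtain ⟨u, hu, v, hv, rfl⟩ := AddSubgroup.mem_sup.mp hy
    exact AddSubgroup.mem_sup.mpr ⟨(x, u), ⟨trivial, hu⟩, (0, v), ⟨zero_mem _, hv⟩, by simp⟩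

theorem isCliqueUnion_mulLeft {N g d k a b : ℕ} [NeZero N] {r c : ZMod N} (hr : r * r = 1)
    (hc : r * c = c) {t : ℤ} (hrt : r = ((1 + g * t : ℤ) : ZMod N)) (hN : N = g * d)
    (ht : IsCoprime (d : ℤ) t) (hk : g.gcd d = k) (ha₀ : 0 < a) (ha : 2 * a + g = N)
    (hb : k * b = g) :
    IsCliqueUnion (cccGraph (Twist.mulLeft r c hr hc).Extension) k a b := by
  have hg : g ≠ 0 := left_ne_zero_of_mul (hN ▸ NeZero.ne N)
  have hsub : AddMonoidHom.mulLeft r - AddMonoidHom.id _ =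
      AddMonoidHom.mulLeft ((g * t : ℤ) : ZMod N) := by
    ext x
    rw [AddMonoidHom.sub_apply, AddMonoidHom.coe_mulLeft, AddMonoidHom.coe_mulLeft,
      AddMonoidHom.id_apply, hrt]
    push_cast
    ring
  subst hN
  have hmoved : (Twist.mulLeft r c hr hc).moved.index = g := by
    rw [Twist.moved, Twist.mulLeft, hsub, index_range_mulLeft ht]
  have hsup : ((Twist.mulLeft r c hr hc).fixed ⊔ (Twist.mulLeft r c hr hc).moved).index = k := by
    rw [Twist.fixed, Twist.moved, Twist.mulLeft, hsub, index_ker_sup_range_mulLeft hg ht, hk]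
  exact Twist.isCliqueUnion _ ha₀ hsup (by rw [hmoved, ha, Nat.card_zmod]) (by rw [hmoved, hb])

theorem isCliqueUnion_dihedralGroup {n g d k a b : ℕ} {t : ℤ} (hn : n = g * d) (hgt : g * t = -2)
    (ht : IsCoprime (d : ℤ) t) (hk : g.gcd d = k) (ha₀ : 0 < a) (ha : 2 * a + g = n)
    (hb : k * b = g) : IsCliqueUnion (cccGraph (DihedralGroup n)) k a b := by
  have : NeZero n := ⟨by omega⟩
  refine IsCliqueUnion.of_iso ?_ (cccGraphCongr (dihedralMulEquiv n))
  exact isCliqueUnion_mulLeft _ _ (by rw [hgt]; norm_num) hn ht hk ha₀ ha hb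

theorem isCliqueUnion_quaternionGroup {n k a b : ℕ} (hk : Nat.gcd 2 n = k) (ha₀ : 0 < a)
    (ha : a + 1 = n) (hb : k * b = 2) : IsCliqueUnion (cccGraph (QuaternionGroup n)) k a b := by
  have : NeZero (2 * n) := ⟨by omega⟩
  refine IsCliqueUnion.of_iso ?_ (cccGraphCongr (quaternionMulEquiv n))
  exact isCliqueUnion_mulLeft (t := -1) _ _ (by norm_num) rfl isCoprime_one_right.neg_right hk ha₀
    (by omega) hb

theorem isCliqueUnion_groupSD {n g d k a b : ℕ} {t : ℤ} (hn : 4 * n = g * d)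
    (hgt : g * t = 2 * n - 2) (ht : IsCoprime (d : ℤ) t) (hk : g.gcd d = k) (ha₀ : 0 < a)
    (ha : 2 * a + g = 4 * n) (hb : k * b = g) : IsCliqueUnion (cccGraph (GroupSD n)) k a b := by
  have : NeZero n := ⟨by omega⟩
  have : NeZero (4 * n) := ⟨by omega⟩
  refine IsCliqueUnion.of_iso ?_ (cccGraphCongr (groupSDMulEquiv n))
  exact isCliqueUnion_mulLeft _ _ (by rw [hgt]; push_cast; ring) hn ht hk ha₀ ha hb

theorem isCliqueUnion_groupU {n m g d k a b : ℕ} {t : ℤ} (hm : m = g * d) (hgt : g * t = -2)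
    (ht : IsCoprime (d : ℤ) t) (hk : g.gcd d = k) (ha₀ : 0 < a) (ha : 2 * a + n * g = n * m)
    (hb : k * b = n * g) : IsCliqueUnion (cccGraph (GroupU n m)) k a b := by
  have hnm : n * m ≠ 0 := by omega
  have : NeZero n := ⟨left_ne_zero_of_mul hnm⟩
  have : NeZero m := ⟨right_ne_zero_of_mul hnm⟩
  have hg : g ≠ 0 := left_ne_zero_of_mul (hm ▸ NeZero.ne m)
  have hsub : AddMonoidHom.mulLeft ((1, -1) : ZMod n × ZMod m) - AddMonoidHom.id _ =
      AddMonoidHom.prodMap 0 (AddMonoidHom.mulLeft ((g * t : ℤ) : ZMod m)) := by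
    rw [hgt]
    ext x
    · exact (congrArg (· - x.1) (one_mul x.1)).trans (sub_self x.1)
    · exact show -1 * x.2 - x.2 = ((-2 : ℤ) : ZMod m) * x.2 by push_cast; ring
  subst hm
  have hmoved : (twistU n (g * d)).moved.index = n * g := by
    rw [Twist.moved, twistU, Twist.mulLeft, hsub, AddMonoidHom.range_prodMap,
      AddSubgroup.index_prod, index_range_mulLeft ht, AddMonoidHom.range_zero,
      AddSubgroup.index_bot, Nat.card_zmod]
  have hsup : ((twistU n (g * d)).fixed ⊔ (twistU n (g * d)).moved).index = k := by
    rw [Twist.fixed, Twist.moved, twistU, Twist.mulLeft, hsub, ker_sup_range_prodMap_zero,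
      AddSubgroup.index_prod, AddSubgroup.index_top, one_mul, index_ker_sup_range_mulLeft hg ht, hk]
  refine IsCliqueUnion.of_iso ?_ (cccGraphCongr (groupUMulEquiv n (g * d)))
  refine (twistU n (g * d)).isCliqueUnion ha₀ hsup ?_ (by rw [hmoved, hb])
  rw [hmoved, ha, Nat.card_prod, Nat.card_zmod, Nat.card_zmod]

theorem isEmpty_vertex_groupU_two (n : ℕ) : IsEmpty (Vertex (GroupU n 2)) :=
  have := (twistU n 2).isEmpty_vertex fun a => Prod.ext (one_mul _) (by
    exact (neg_one_mul _).trans (ZMod.neg_eq_self_mod_two a.2))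
  (vertexCongr (groupUMulEquiv n 2)).isEmpty

theorem comparison_of_isEmpty {V : Type*} [Fintype V] [IsEmpty V] (G : SimpleGraph V) :
    IsCNLBorderenergetic G ∧ ¬ IsCNLHyperenergetic G ∧
      IsCNSLBorderenergetic G ∧ ¬ IsCNSLHyperenergetic G := by
  obtain rfl : G = ⊤ := Subsingleton.elim _ _
  exact ⟨rfl, lt_irrefl _, rfl, lt_irrefl _⟩

theorem strictComparison_dihedralGroup_of_even {n : ℕ} [NeZero n] (hn : 3 ≤ n) (h : Even n) :
    StrictComparison (cccGraph (DihedralGroup n)) (13 ≤ n) (20 ≤ n) := by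
  obtain ⟨l, rfl⟩ := even_iff_two_dvd.mp h
  have hgcd : Nat.gcd 2 l * (2 / Nat.gcd 2 l) = 2 := Nat.mul_div_cancel' (Nat.gcd_dvd_left 2 l)
  have h := isCliqueUnion_dihedralGroup (a := l - 1) (t := -1) rfl (by norm_num)
    isCoprime_one_right.neg_right rfl (by omega) (by omega) hgcd
  exact (h.strictComparison_of_two hgcd (by omega)).congr (by omega) (by omega)

theorem classification_dihedralGroup {n : ℕ} [NeZero n] (hn : 3 ≤ n) :
    (IsCNLBorderenergetic (cccGraph (DihedralGroup n)) ↔ n = 3 ∨ n = 11) ∧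
    (IsCNLHyperenergetic (cccGraph (DihedralGroup n)) ↔ 13 ≤ n) ∧
    (IsCNSLBorderenergetic (cccGraph (DihedralGroup n)) ↔ n = 3) ∧
    (IsCNSLHyperenergetic (cccGraph (DihedralGroup n)) ↔ Even n ∧ 20 ≤ n) := by
  by_cases hn2 : Even n
  · obtain ⟨h1, h2, h3, h4⟩ := strictComparison_dihedralGroup_of_even hn hn2
    have := even_iff_two_dvd.mp hn2
    exact ⟨iff_of_false h1 (by omega), h2, iff_of_false h3 (by omega),
      h4.trans (and_iff_right hn2).symm⟩
  · obtain ⟨l, rfl⟩ := Nat.not_even_iff_odd.mp hn2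
    have h : IsCliqueUnion (cccGraph (DihedralGroup (2 * l + 1))) 1 l 1 :=
      isCliqueUnion_dihedralGroup (one_mul _).symm (one_mul _) ⟨1, l, by push_cast; ring⟩
        (Nat.gcd_one_left _) (by omega) rfl rfl
    obtain ⟨h1, h2, h3, h4⟩ := h.comparison_of_one_one (by omega)
    exact ⟨h1.trans (by omega), h2.trans (by omega), h3.trans (by omega),
      iff_of_false h4 (mt And.left hn2)⟩

theorem strictComparison_quaternionGroup {n : ℕ} [NeZero n] (hn : 2 ≤ n) :
    StrictComparison (cccGraph (QuaternionGroup n)) (7 ≤ n) (10 ≤ n) := by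
  have hgcd : Nat.gcd 2 n * (2 / Nat.gcd 2 n) = 2 := Nat.mul_div_cancel' (Nat.gcd_dvd_left 2 n)
  have h := isCliqueUnion_quaternionGroup (n := n) (a := n - 1) rfl (by omega) (by omega) hgcd
  exact (h.strictComparison_of_two hgcd (by omega)).congr (by omega) (by omega)

theorem strictComparison_groupSD {n : ℕ} [NeZero n] (hn : 2 ≤ n) :
    StrictComparison (cccGraph (GroupSD n)) (4 ≤ n) (6 ≤ n) := by
  obtain ⟨l, rfl | rfl⟩ := n.even_or_odd'
  · have h : IsCliqueUnion (cccGraph (GroupSD (2 * l))) 2 (4 * l - 1) 1 :=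
      isCliqueUnion_groupSD (g := 2) (d := 4 * l) (t := 2 * l - 1) (by ring) (by push_cast; ring)
        ⟨1 - l, 2 * l - 1, by push_cast; ring⟩
        (Nat.gcd_eq_left ⟨2 * l, by ring⟩) (by omega) (by omega) rfl
    exact (h.strictComparison_of_two rfl (by omega)).congr (by omega) (by omega)
  · have h : IsCliqueUnion (cccGraph (GroupSD (2 * l + 1))) 1 (l * 4) 4 :=
      isCliqueUnion_groupSD (g := 4) (d := 2 * l + 1) (t := l) rfl (by push_cast; ring)
        ⟨1, -2, by push_cast; ring⟩ (show Nat.Coprime (2 ^ 2) _ from .pow_left 2 (by simp))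
        (by omega) (by omega) rfl
    exact (h.strictComparison_of_mul_one (by omega) (by omega)).congr (by omega) (by omega)

theorem strictComparison_groupU {n m : ℕ} [NeZero n] [NeZero m] (hn : 2 ≤ n) (hm : 3 ≤ m) :
    StrictComparison (cccGraph (GroupU n m))
      (¬ (m = 3 ∨ (m = 5 ∧ (n = 2 ∨ n = 3)) ∨ m = 4 ∨ (m = 8 ∧ n = 2) ∨ m = 6))
      (¬ (m = 3 ∨ ((m = 5 ∨ m = 7 ∨ m = 9) ∧ n = 2) ∨ (m = 5 ∧ (n = 3 ∨ n = 4)) ∨ m = 4 ∨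
        (m = 8 ∧ n = 2) ∨ m = 6 ∨ (m = 10 ∧ n = 2))) := by
  obtain ⟨q, rfl | rfl | rfl⟩ : ∃ q, m = 2 * q + 1 ∨ m = 2 * (2 * q + 1) ∨ m = 2 * (2 * q) :=
    ⟨if m % 2 = 1 then m / 2 else m / 4, by split_ifs <;> omega⟩
  · have h : IsCliqueUnion (cccGraph (GroupU n (2 * q + 1))) 1 (q * n) n :=
      isCliqueUnion_groupU (one_mul _).symm (one_mul _) ⟨1, q, by push_cast; ring⟩
        (Nat.gcd_one_left _) (Nat.mul_pos (by omega) (by omega)) (by ring) (by ring)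
    exact (h.strictComparison_of_mul_one (by omega) hn).congr (by omega) (by omega)
  · have h : IsCliqueUnion (cccGraph (GroupU n (2 * (2 * q + 1)))) 1 (q * (2 * n)) (2 * n) :=
      isCliqueUnion_groupU (t := -1) rfl (by norm_num) isCoprime_one_right.neg_right
        (by simp) (Nat.mul_pos (by omega) (by omega)) (by ring) (by ring)
    exact (h.strictComparison_of_mul_one (by omega) (by omega)).congr (by omega) (by omega)
  · obtain ⟨p, rfl⟩ : ∃ p, q = p + 1 := ⟨q - 1, by omega⟩
    have h : IsCliqueUnion (cccGraph (GroupU n (2 * (2 * (p + 1))))) 2 ((2 * p + 1) * n) n :=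
      isCliqueUnion_groupU (t := -1) rfl (by norm_num) isCoprime_one_right.neg_right
        (Nat.gcd_mul_right_right _ _) (Nat.mul_pos (by omega) (by omega)) (by ring) (by ring)
    exact (h.strictComparison_of_mul_two (by omega) hn).congr (by omega) (by omega)

end CCC

theorem mainTheorem4 :
    -- the dihedral groups `D_{2n}`
    (∀ (n : ℕ) [NeZero n], 3 ≤ n →
      (CCC.IsCNLBorderenergetic (CCC.cccGraph (DihedralGroup n)) ↔ n = 3 ∨ n = 11) ∧
      (CCC.IsCNLHyperenergetic (CCC.cccGraph (DihedralGroup n)) ↔ 13 ≤ n) ∧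
      (CCC.IsCNSLBorderenergetic (CCC.cccGraph (DihedralGroup n)) ↔ n = 3) ∧
      (CCC.IsCNSLHyperenergetic (CCC.cccGraph (DihedralGroup n)) ↔ Even n ∧ 20 ≤ n)) ∧
    -- the dicyclic groups `T_{4n}`
    (∀ (n : ℕ) [NeZero n], 2 ≤ n →
      ¬ CCC.IsCNLBorderenergetic (CCC.cccGraph (QuaternionGroup n)) ∧
      (CCC.IsCNLHyperenergetic (CCC.cccGraph (QuaternionGroup n)) ↔ 7 ≤ n) ∧
      ¬ CCC.IsCNSLBorderenergetic (CCC.cccGraph (QuaternionGroup n)) ∧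
      (CCC.IsCNSLHyperenergetic (CCC.cccGraph (QuaternionGroup n)) ↔ 10 ≤ n)) ∧
    -- the groups `U_{6n}`
    (∀ (n : ℕ) [NeZero n], 2 ≤ n →
      ¬ CCC.IsCNLBorderenergetic (CCC.cccGraph (CCC.GroupU6 n)) ∧
      ¬ CCC.IsCNLHyperenergetic (CCC.cccGraph (CCC.GroupU6 n)) ∧
      ¬ CCC.IsCNSLBorderenergetic (CCC.cccGraph (CCC.GroupU6 n)) ∧
      ¬ CCC.IsCNSLHyperenergetic (CCC.cccGraph (CCC.GroupU6 n))) ∧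
    -- the semidihedral groups `SD_{8n}`
    (∀ (n : ℕ) [NeZero n], 2 ≤ n →
      ¬ CCC.IsCNLBorderenergetic (CCC.cccGraph (CCC.GroupSD n)) ∧
      (CCC.IsCNLHyperenergetic (CCC.cccGraph (CCC.GroupSD n)) ↔ 4 ≤ n) ∧
      ¬ CCC.IsCNSLBorderenergetic (CCC.cccGraph (CCC.GroupSD n)) ∧
      (CCC.IsCNSLHyperenergetic (CCC.cccGraph (CCC.GroupSD n)) ↔ 6 ≤ n)) ∧
    -- the groups `U_{(n,m)}`
    (∀ (n m : ℕ) [NeZero n] [NeZero m], 2 ≤ n → 2 ≤ m →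
      (CCC.IsCNLBorderenergetic (CCC.cccGraph (CCC.GroupU n m)) ↔ m = 2) ∧
      (CCC.IsCNLHyperenergetic (CCC.cccGraph (CCC.GroupU n m)) ↔
        ¬ (m = 2 ∨ m = 3 ∨ (m = 5 ∧ (n = 2 ∨ n = 3)) ∨ m = 4 ∨ (m = 8 ∧ n = 2) ∨ m = 6)) ∧
      (CCC.IsCNSLBorderenergetic (CCC.cccGraph (CCC.GroupU n m)) ↔ m = 2) ∧
      (CCC.IsCNSLHyperenergetic (CCC.cccGraph (CCC.GroupU n m)) ↔
        ¬ (m = 2 ∨ m = 3 ∨ ((m = 5 ∨ m = 7 ∨ m = 9) ∧ n = 2) ∨ (m = 5 ∧ (n = 3 ∨ n = 4)) ∨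
          m = 4 ∨ (m = 8 ∧ n = 2) ∨ m = 6 ∨ (m = 10 ∧ n = 2)))) := by
  refine ⟨fun n _ => CCC.classification_dihedralGroup, fun n _ hn => ?_, fun n _ hn => ?_,
    fun n _ hn => ?_, fun n m _ _ hn hm => ?_⟩
  · obtain ⟨h1, h2, h3, h4⟩ := CCC.strictComparison_quaternionGroup hn
    exact ⟨h1, h2, h3, h4⟩
  · obtain ⟨h1, h2, h3, h4⟩ := CCC.strictComparison_groupU hn le_rfl
    exact ⟨h1, fun h => h2.mp h (by simp), h3, fun h => h4.mp h (by simp)⟩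
  · obtain ⟨h1, h2, h3, h4⟩ := CCC.strictComparison_groupSD hn
    exact ⟨h1, h2, h3, h4⟩
  · obtain rfl | hm3 : m = 2 ∨ 3 ≤ m := by omega
    · have := CCC.isEmpty_vertex_groupU_two n
      obtain ⟨h1, h2, h3, h4⟩ := CCC.comparison_of_isEmpty (CCC.cccGraph (CCC.GroupU n 2))
      exact ⟨iff_of_true h1 rfl, iff_of_false h2 (by simp), iff_of_true h3 rfl,
        iff_of_false h4 (by simp)⟩
    · obtain ⟨h1, h2, h3, h4⟩ := CCC.strictComparison_groupU hn hm3
      exact ⟨iff_of_false h1 (by omega), h2.trans (by omega), iff_of_false h3 (by omega),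
        h4.trans (by omega)⟩
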